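/- **Theorem (convergence of the post-decision-state learning algorithm).** *Model.* Workload, environment and congestion states $\lambda,e,h$ lie in finite sets and evolve as Markov chains with transition matrices $P_\lambda,P_e,P_h$; given the current $e(t)$, the green power budget $g(t)\ge 0$ has a discrete law $P_g(\cdot\mid e(t))$. Jointly: conditionally on the history up to slot $t$ (including the current action), $g(t)$ and the three next exogenous states are independent with these laws. A state is $s=(x,b)$ with $x=(\lambda,e,h)$ and $b$ in a finite set $\mathcal B\subset[0,B]$ of battery levels; post-decision states are $\tilde s=(x,\tilde b)$ with $\tilde b$ in a finite set $\tilde{\mathcal B}\subset[0,B]$. Let $d_{op}(\lambda)\ge0$ be the base station's power demand. An action $a$ from a finite set $\mathcal A\subset[0,\infty)$, $0\in\mathcal A$, is admissible at $s$ if $a\le\max\{b-d_{op}(\lambda),0\}$ and some control $(m,\mu)$ realizes it; a control consists of a number $m\in\{0,\dots,M\}$ of active servers and a local workload $0\le\mu\le\lambda$ of finite delay with computing power demand $d_{com}(m,\mu)=a$; if $d_{op}(\lambda)>b$ only $(m,\mu)=(0,0)$ is allowed. The post-decision state $\tilde s(s,a)$ has the same $x$ and $\tilde b=b$ if $d_{op}(\lambda)>b$,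 $\tilde b=\max\{b-d_{op}(\lambda)-a,0\}$ otherwise; the next battery level is $\min\{\tilde b+g,B\}$, and $\mathcal B,\tilde{\mathcal B}$ are closed under these maps. The realized one-slot cost $c(s,a,g)$ is the minimum over all controls realizing $a$ (assumed attained) of the delay cost (local delay $c_{lo}(m,\mu)$, plus $(\lambda-\mu)\max\{h-d_0,0\}$ for offloading, plus the wireless delay), plus $\phi\, d_{op}(\lambda)$ if $d_{op}(\lambda)>b$ and plus $\omega\max\{a-g,0\}$ otherwise, where $\phi,\omega>0$. Put $c(s,a)=\mathbb E[c(s,a,g)\mid e]$. With discount factor $\delta\in[0,1)$, let $C^\pi(s)=\mathbb E_s^\pi\big[\sum_t\delta^tc(s(t),a(t))\big]$, let $C^*(s)=\min_\pi C^\pi(s)$ over policies $\pi$ mapping states to admissible actions, and let $V^*(\tilde s)=\sum_{s'}P(s'\mid\tilde s)\,C^*(s')$, where $P(s'\mid\tilde s)$ is the probability that $s'$ follows $\tilde s$. *Algorithm.* Start from arbitrary estimates $\hat c^0,\hat C^0,\hat V^0$. In slot $t$, with exogenous state $x(t)$ and battery level $b(t)$, choose an admissible $a(t)$ minimizing $\hat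 c^t(s(t),a)+\delta\hat V^t(\tilde s(s(t),a))$. After $g(t)$ and the next state have been observed, update: (i) for all $(s,a)$ whose environment component is $e(t)$: $\hat c^{t+1}(s,a)=(1-\rho^t)\hat c^t(s,a)+\rho^tc(s,a,g(t))$; (ii) for all $s$ whose environment component is $e(t)$: $\hat C^{t+1}(s)=\min_a\big(\hat c^{t+1}(s,a)+\delta\hat V^t(\tilde s(s,a))\big)$; (iii) for all $\tilde s=(x(t),\tilde b)$: $\hat V^{t+1}(\tilde s)=(1-\alpha^t)\hat V^t(\tilde s)+\alpha^t\hat C^{t+1}\big(x(t+1),\min\{\tilde b+g(t),B\}\big)$. All other estimates are unchanged. *Claim.* Let the deterministic learning rates satisfy $\alpha^t,\rho^t\ge0$, $\sum_t\alpha^t=\sum_t\rho^t=\infty$, $\sum_t(\alpha^t)^2<\infty$, $\sum_t(\rho^t)^2<\infty$. Say that the algorithm *converges* if, as $t\to\infty$, $\hat V^t(\tilde s)\to V^*(\tilde s)$ for all $\tilde s$, $\hat C^t(s)\to C^*(s)$ for all $s$, $\hat c^t(s,a)\to c(s,a)$ for all $s$ and admissible $a$, and, for all sufficiently large $t$, every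 policy that is greedy for $(\hat c^t,\hat V^t)$ in all states has value $C^*$ and, combined with delay-minimizing controls, is an optimal joint power, offloading and autoscaling policy (from every initial state). Then: 1. $C^*(s)=\min_a\big(c(s,a)+\delta V^*(\tilde s(s,a))\big)$ for all $s$. 2. Almost surely, if $\sum_{t:\,x(t)=x}\alpha^t=\infty$ for every exogenous state $x$ and $\sum_{t:\,e(t)=e}\rho^t=\infty$ for every environment state $e$, then the algorithm converges. 3. If the joint chain $x(t)$ is irreducible, and moreover it is aperiodic or both learning-rate sequences are nonincreasing, then the algorithm converges almost surely. -/

import Mathlib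

open MeasureTheory Filter Topology

noncomputable section

/-- The data of a renewable-powered mobile edge system. `L` is the set of locations of the service
area, `W`, `E`, `H` are the finite sets of workload, environment and network congestion states and
`G` is the (countable) set of possible green power realizations. -/
structure EdgeParams (L W E H G : Type*) where
  /-- `arr w x`: workload arrival rate at location `x` in workload state `w`. -/
  arr : W → L → ℝ
  /-- `txRate w x`: wireless transmission rate between the base station and `x`. -/
  txRate : W → L → ℝ
  /-- Static power consumption of the base station. -/
  dsta : ℝ
  /-- Dynamic power consumption of the base station, as a function of the total workload. -/
  ddyn : ℝ → ℝ
  /-- `dcom m μ`: computing power demand of `m` active servers processing local workload `μ`. -/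
  dcom : ℕ → ℝ → ℝ
  /-- `clo m μ`: delay cost of the workload `μ` processed by `m` local servers. -/
  clo : ℕ → ℝ → ℝ
  /-- The pairs `(m, μ)` at which the local delay cost is finite. -/
  cloDom : Set (ℕ × ℝ)
  /-- Round trip time in a congestion state. -/
  rtt : H → ℝ
  /-- Delay threshold in the offloading cost. -/
  d0 : ℝ
  /-- Number of servers. -/
  servers : ℕ
  /-- Unit cost of the backup power supply. -/
  phi : ℝ
  /-- Unit battery depreciation cost. -/
  omega : ℝ
  /-- Discount factor. -/
  disc : ℝ
  /-- Battery capacity. -/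
  cap : ℝ
  /-- The battery levels. -/
  bat : Finset ℝ
  /-- The post-decision battery levels. -/
  pbat : Finset ℝ
  /-- The computing power demands. -/
  act : Finset ℝ
  /-- Transition matrix of the workload. -/
  PW : Matrix W W ℝ
  /-- Transition matrix of the environment. -/
  PE : Matrix E E ℝ
  /-- Transition matrix of the network congestion. -/
  PH : Matrix H H ℝ
  /-- Green power budget of a realization. -/
  green : G → ℝ
  /-- `Pg e γ`: conditional probability of the realization `γ` in environment state `e`. -/
  Pg : E → G → ℝ

namespace EdgeParams

variable {L W E H G : Type*} (M : EdgeParams L W E H G)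

/-- A normal state `((λ, e, h), b)`: exogenous part and battery level. -/
abbrev State : Type _ := (W × E × H) × {b : ℝ // b ∈ M.bat}

/-- A post-decision state `((λ, e, h), b)`. -/
abbrev PState : Type _ := (W × E × H) × {b : ℝ // b ∈ M.pbat}

/-- Total workload arrival rate. -/
def load [Fintype L] (w : W) : ℝ := ∑ x, M.arr w x

/-- Average utilization of the base station. -/
def util [Fintype L] (w : W) : ℝ := ∑ x, M.arr w x / M.txRate w x

/-- Basic operation and transmission power demand. -/
def dop [Fintype L] (w : W) : ℝ := M.dsta + M.ddyn (M.load w)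

/-- Wireless access and transmission delay cost. -/
def cwi [Fintype L] (w : W) : ℝ := ∑ x, M.arr w x / (M.txRate w x * (1 - M.util w))

/-- Delay cost of offloading all but `μ` of the workload. -/
def coff [Fintype L] (h : H) (w : W) (μ : ℝ) : ℝ := (M.load w - μ) * max (M.rtt h - M.d0) 0

/-- Total delay cost with autoscaling action `p.1` and local workload `p.2`. -/
def cdelay [Fintype L] (h : H) (w : W) (p : ℕ × ℝ) : ℝ :=
  M.clo p.1 p.2 + M.coff h w p.2 + M.cwi w

/-- The battery cannot support the basic operation: the backup power supply is used. -/
def Backup [Fintype L] (w : W) (b : ℝ) : Prop := M.dop w > b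

open Classical in
/-- The pairs (number of active servers, local workload) which realize the computing power demand
`a` in workload state `w` with battery level `b`. -/
def controls [Fintype L] (w : W) (b a : ℝ) : Set (ℕ × ℝ) :=
  if M.Backup w b then {(0, 0)}
  else {p | p.1 ≤ M.servers ∧ 0 ≤ p.2 ∧ p.2 ≤ M.load w ∧ p ∈ M.cloDom ∧ M.dcom p.1 p.2 = a}

/-- The admissible computing power demands. -/
def avail [Fintype L] (w : W) (b : ℝ) : Set ℝ :=
  {a | a ∈ M.act ∧ a ≤ max (b - M.dop w) 0 ∧ (M.controls w b a).Nonempty}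

open Classical in
/-- Post-decision battery level. -/
def postLevel [Fintype L] (w : W) (b a : ℝ) : ℝ :=
  if M.Backup w b then b else max (b - M.dop w - a) 0

open Classical in
/-- Battery level at the next time slot when the green power budget is `g`. -/
def nextLevel [Fintype L] (w : W) (b a g : ℝ) : ℝ :=
  if M.Backup w b then max (min (b + g) M.cap) 0
  else max (min (b - M.dop w - a + g) M.cap) 0

/-- Transition matrix of the exogenous state `(λ, e, h)`. -/
def Pexo : Matrix (W × E × H) (W × E × H) ℝ :=
  Matrix.of fun x y => M.PW x.1 y.1 * M.PE x.2.1 y.2.1 * M.PH x.2.2 y.2.2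

end EdgeParams

/-- A renewable-powered mobile edge system: the data above, subject to the rules of the model.
The finite sets of battery levels are closed under the battery dynamics. -/
structure EdgeSystem (L W E H G : Type*) [Fintype L] [Fintype W] [Fintype E] [Fintype H]
    [DecidableEq W] [DecidableEq E] [DecidableEq H] extends EdgeParams L W E H G where
  arr_nonneg : ∀ w x, 0 ≤ arr w x
  txRate_pos : ∀ w x, 0 < txRate w x
  util_lt_one : ∀ w, toEdgeParams.util w < 1
  dsta_nonneg : 0 ≤ dsta
  ddyn_nonneg : ∀ r, 0 ≤ ddyn r
  dcom_zero : dcom 0 0 = 0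
  dcom_mono : ∀ m m' : ℕ, ∀ μ μ' : ℝ, m ≤ m' → 0 ≤ μ → μ ≤ μ' → dcom m μ ≤ dcom m' μ'
  zero_mem_cloDom : (0, 0) ∈ cloDom
  phi_pos : 0 < phi
  omega_pos : 0 < omega
  disc_nonneg : 0 ≤ disc
  disc_lt_one : disc < 1
  bat_range : ∀ b ∈ bat, 0 ≤ b ∧ b ≤ cap
  pbat_range : ∀ b ∈ pbat, 0 ≤ b ∧ b ≤ cap
  act_nonneg : ∀ a ∈ act, 0 ≤ a
  zero_mem_act : (0 : ℝ) ∈ act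
  PW_stochastic : PW ∈ Matrix.rowStochastic ℝ W
  PE_stochastic : PE ∈ Matrix.rowStochastic ℝ E
  PH_stochastic : PH ∈ Matrix.rowStochastic ℝ H
  green_nonneg : ∀ γ, 0 ≤ green γ
  Pg_nonneg : ∀ e γ, 0 ≤ Pg e γ
  Pg_sum : ∀ e, HasSum (Pg e) 1
  post_mem : ∀ w, ∀ b ∈ bat, ∀ a ∈ toEdgeParams.avail w b, toEdgeParams.postLevel w b a ∈ pbat
  next_mem : ∀ b ∈ pbat, ∀ γ, min (b + green γ) cap ∈ bat
  /-- The myopic offloading and autoscaling problem has a solution. -/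
  exists_control : ∀ h w, ∀ b ∈ bat, ∀ a ∈ toEdgeParams.avail w b,
    ∃ p ∈ toEdgeParams.controls w b a, ∀ q ∈ toEdgeParams.controls w b a,
      toEdgeParams.cdelay h w p ≤ toEdgeParams.cdelay h w q

namespace EdgeSystem

variable {L W E H G : Type*} [Fintype L] [Fintype W] [Fintype E] [Fintype H]
  [DecidableEq W] [DecidableEq E] [DecidableEq H] (M : EdgeSystem L W E H G)

/-- The admissible actions in a state. -/
abbrev Act (s : M.State) : Type := {a : ℝ // a ∈ M.avail s.1.1 s.2.1}

/-- The action `a = 0` (all workload is offloaded) is always admissible. -/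
lemma zero_mem_avail (w : W) (b : ℝ) : (0 : ℝ) ∈ M.avail w b := by
  refine ⟨M.zero_mem_act, le_max_right _ _, (0, 0), ?_⟩
  unfold EdgeParams.controls
  split_ifs
  · rfl
  · exact ⟨Nat.zero_le _, le_refl _, Finset.sum_nonneg fun x _ => M.arr_nonneg w x,
      M.zero_mem_cloDom, M.dcom_zero⟩

instance (s : M.State) : Nonempty (M.Act s) := ⟨⟨0, M.zero_mem_avail _ _⟩⟩

instance (s : M.State) : Finite (M.Act s) :=
  Set.Finite.to_subtype (M.act.finite_toSet.subset fun _ h => h.1)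

/-- The post-decision state after action `a` in state `s`. -/
def post (s : M.State) (a : M.Act s) : M.PState :=
  (s.1, ⟨M.postLevel s.1.1 s.2.1 a.1, M.post_mem _ _ s.2.2 _ a.2⟩)

/-- The battery level `min (b + g) B` reached from a post-decision battery level. -/
def nextBat (b : {b : ℝ // b ∈ M.pbat}) (γ : G) : {b : ℝ // b ∈ M.bat} :=
  ⟨min (b.1 + M.green γ) M.cap, M.next_mem _ b.2 γ⟩

/-- The optimal delay cost given the state and the computing power demand. -/
def cdelayOpt (s : M.State) (a : M.Act s) : ℝ :=
  sInf (M.cdelay s.1.2.2 s.1.1 '' M.controls s.1.1 s.2.1 a.1)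

/-- Optimal offloading and autoscaling actions given the state and the computing power demand. -/
def IsOptControl (s : M.State) (a : M.Act s) (p : ℕ × ℝ) : Prop :=
  p ∈ M.controls s.1.1 s.2.1 a.1 ∧
    ∀ q ∈ M.controls s.1.1 s.2.1 a.1, M.cdelay s.1.2.2 s.1.1 p ≤ M.cdelay s.1.2.2 s.1.1 q

open Classical in
/-- Cost of the power supply (backup supply or battery depreciation) given the green power. -/
def powerCost (s : M.State) (a g : ℝ) : ℝ :=
  if M.Backup s.1.1 s.2.1 then M.phi * M.dop s.1.1 else M.omega * max (a - g) 0

/-- The realized one-slot cost `c(s, a, g)`. -/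
def costG (s : M.State) (a : M.Act s) (γ : G) : ℝ :=
  M.cdelayOpt s a + M.powerCost s a.1 (M.green γ)

/-- The expected one-slot cost `c(s, a)`. -/
def cost (s : M.State) (a : M.Act s) : ℝ :=
  M.cdelayOpt s a + ∑' γ, M.Pg s.1.2.1 γ * M.powerCost s a.1 (M.green γ)

/-- The expected one-slot cost with power demand `a` and offloading and autoscaling action `p`. -/
def jointCost (s : M.State) (a : M.Act s) (p : ℕ × ℝ) : ℝ :=
  M.cdelay s.1.2.2 s.1.1 p + ∑' γ, M.Pg s.1.2.1 γ * M.powerCost s a.1 (M.green γ)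

open Classical in
/-- The transition probability `P(s' | s, a)`. -/
def trans (s : M.State) (a : M.Act s) (s' : M.State) : ℝ :=
  M.Pexo s.1 s'.1 * ∑' γ, M.Pg s.1.2.1 γ *
    (if s'.2.1 = M.nextLevel s.1.1 s.2.1 a.1 (M.green γ) then 1 else 0)

open Classical in
/-- The transition probability `P(s' | s)` from a post-decision state to a normal state. -/
def ptrans (p : M.PState) (s' : M.State) : ℝ :=
  M.Pexo p.1 s'.1 * ∑' γ, M.Pg p.1.2.1 γ *
    (if s'.2.1 = min (p.2.1 + M.green γ) M.cap then 1 else 0)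

/-- A computing power demand policy. -/
abbrev Policy : Type _ := (s : M.State) → M.Act s

/-- Transition matrix of the state process under a policy. -/
def policyMatrix (π : M.Policy) : Matrix M.State M.State ℝ :=
  Matrix.of fun s s' => M.trans s (π s) s'

/-- Expected discounted sum of the one-slot costs `c` under a policy; the expected cost of
slot `t` is obtained from the `t`-step transition matrix. -/
def discounted (π : M.Policy) (c : M.State → ℝ) (s : M.State) : ℝ :=
  ∑' t : ℕ, M.disc ^ t * ((M.policyMatrix π) ^ t).mulVec c s

/-- The value `C^π(s)` of a policy. -/
def value (π : M.Policy) (s : M.State) : ℝ :=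
  M.discounted π (fun s => M.cost s (π s)) s

/-- The expected discounted cost of a joint power demand, offloading and autoscaling policy. -/
def jointValue (π : M.Policy) (u : M.State → ℕ × ℝ) (s : M.State) : ℝ :=
  M.discounted π (fun s => M.jointCost s (π s) (u s)) s

/-- The optimal value function `C*`. -/
def optValue (s : M.State) : ℝ := ⨅ π : M.Policy, M.value π s

/-- The optimal post-decision value function `V*`. -/
def optPValue (p : M.PState) : ℝ := ∑ s', M.ptrans p s' * M.optValue s'

/-- The estimates maintained by the learning algorithm: one-slot cost, post-decision value and
normal value. -/
structure Estimates where
  c : (s : M.State) → M.Act s → ℝ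
  V : M.PState → ℝ
  C : M.State → ℝ

/-- `a` minimizes the estimated cost-to-go in state `s`. -/
def Greedy (X : M.Estimates) (s : M.State) (a : M.Act s) : Prop :=
  ∀ a' : M.Act s, X.c s a + M.disc * X.V (M.post s a) ≤ X.c s a' + M.disc * X.V (M.post s a')

/-- Batch update of the one-slot cost estimates (exogenous state `x`, green power `γ`). -/
def updC (X : M.Estimates) (ρ : ℝ) (x : W × E × H) (γ : G) (s : M.State) (a : M.Act s) : ℝ :=
  if s.1.2.1 = x.2.1 then (1 - ρ) * X.c s a + ρ * M.costG s a γ else X.c s a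

/-- Batch update of the normal value estimates. -/
def updN (X : M.Estimates) (ρ : ℝ) (x : W × E × H) (γ : G) (s : M.State) : ℝ :=
  if s.1.2.1 = x.2.1 then
    ⨅ a : M.Act s, (M.updC X ρ x γ s a + M.disc * X.V (M.post s a))
  else X.C s

/-- Batch update of the post-decision value estimates (`x'` is the next exogenous state). -/
def updV (X : M.Estimates) (ρ α : ℝ) (x x' : W × E × H) (γ : G) (p : M.PState) : ℝ :=
  if p.1 = x then (1 - α) * X.V p + α * M.updN X ρ x γ (x', M.nextBat p.2 γ) else X.V p

/-- The estimates at the beginning of slot `t`, started from `X₀`, along the realized exogenous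
states `x` and green power realizations `γ`, with learning rates `ρ` and `α`. -/
def estimates (ρ α : ℕ → ℝ) (X₀ : M.Estimates) (x : ℕ → W × E × H) (γ : ℕ → G) :
    ℕ → M.Estimates
  | 0 => X₀
  | t + 1 =>
    let X := estimates ρ α X₀ x γ t
    { c := M.updC X (ρ t) (x t) (γ t)
      V := M.updV X (ρ t) (α t) (x t) (x (t + 1)) (γ t)
      C := M.updN X (ρ t) (x t) (γ t) }

/-- A run of the learning algorithm in the edge system: `S t` is the state at slot `t`, `A t` the
action chosen by the algorithm, `Γ t` the green power realization. `ℱ t` is the information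
available when the action of slot `t` has been chosen. -/
structure IsRun {Ω : Type*} [mΩ : MeasurableSpace Ω] (P : Measure Ω) (ℱ : Filtration ℕ mΩ)
    (ρ α : ℕ → ℝ) (X₀ : M.Estimates) (S : ℕ → Ω → M.State)
    (A : (t : ℕ) → (ω : Ω) → M.Act (S t ω)) (Γ : ℕ → Ω → G) : Prop where
  state_meas : ∀ t s, MeasurableSet[ℱ t] {ω | S t ω = s}
  act_meas : ∀ t (a : ℝ), MeasurableSet[ℱ t] {ω | (A t ω : ℝ) = a}
  green_meas : ∀ t γ, MeasurableSet[ℱ (t + 1)] {ω | Γ t ω = γ}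
  /-- The conditional law of the green power and of the next exogenous state. -/
  law : ∀ t γ x',
    P[Set.indicator {ω | Γ t ω = γ ∧ (S (t + 1) ω).1 = x'} (fun _ => (1 : ℝ)) | ℱ t]
      =ᵐ[P] fun ω => M.Pg (S t ω).1.2.1 γ * M.Pexo (S t ω).1 x'
  /-- The battery dynamics. -/
  battery : ∀ t ω, ((S (t + 1) ω).2 : ℝ) =
    M.nextLevel (S t ω).1.1 (S t ω).2 (A t ω) (M.green (Γ t ω))
  /-- The algorithm acts greedily with respect to its current estimates. -/
  greedy : ∀ t ω,
    M.Greedy (M.estimates ρ α X₀ (fun k => (S k ω).1) (fun k => Γ k ω) t) (S t ω) (A t ω)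

/-- The estimates `X t` recover an optimal policy: from some slot on, every greedy power demand
policy, together with the corresponding offloading and autoscaling actions, is optimal. -/
def RecoversPolicy (X : ℕ → M.Estimates) : Prop :=
  ∀ᶠ t in atTop, ∀ π : M.Policy, (∀ s, M.Greedy (X t) s (π s)) →
    (∀ s, M.value π s = M.optValue s) ∧
    ∀ u : M.State → ℕ × ℝ, (∀ s, M.IsOptControl s (π s) (u s)) →
      ∀ (π' : M.Policy) (u' : M.State → ℕ × ℝ),
        (∀ s, u' s ∈ M.controls s.1.1 s.2.1 (π' s).1) →
        ∀ s, M.jointValue π u s ≤ M.jointValue π' u' s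

/-- The estimates converge to the optimal post-decision value function, the optimal value function
and the expected one-slot cost, and an optimal policy is recovered. -/
def Converges (X : ℕ → M.Estimates) : Prop :=
  (∀ p, Tendsto (fun t => (X t).V p) atTop (𝓝 (M.optPValue p))) ∧
  (∀ s, Tendsto (fun t => (X t).C s) atTop (𝓝 (M.optValue s))) ∧
  (∀ s a, Tendsto (fun t => (X t).c s a) atTop (𝓝 (M.cost s a))) ∧
  M.RecoversPolicy X

end EdgeSystem

end

/-! The proof joins dynamic programming to asynchronous stochastic approximation.

Dynamic programming. An admissible action never overdraws the battery, so the next state depends on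
state and action only through the post-decision state (`nextLevel_eq`). The Bellman operator is a
sup-norm contraction, and a comparison principle for discounted stochastic matrices identifies its
fixed point with `optValue` (`bellman_optValue`). This is claim 1. Since there are finitely many
actions, accurate estimates eventually have only optimal greedy actions
(`recoversPolicy_of_tendsto`).

Claim 2. The updates act on all battery levels at once, so the estimates are functions of the
exogenous states and green powers alone: actions play no role and no exploration is needed. Each
estimate follows a Robbins-Monro recursion on its own clock, namely the learning rate restricted to
its update slots. The noise is a martingale difference series with square summable bounds, hence
converges almost surely; a convergent noise series is asymptotically harmless
(`eventually_abs_le_of_robbinsMonro`). The cost estimates therefore converge. For the value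
estimates, an eventual error bound `u` improves to `δ u + ε` for every `ε > 0`, and the infimum of
all eventual bounds must be zero (`tendsto_values_of_noise`). A starting bound exists because the
estimates are uniformly bounded.

Claim 3. It remains to show that the rates are not summable along the visits to each exogenous
state. The indicator of a visit `k` slots ahead differs from its conditional probability by a sum of
`k` martingale differences, whose weighted series converge; the conditional probabilities, summed
over a suitable set of lags `k`, are bounded below (`ae_tendsto_sum_visits`). -/

noncomputable section

/-! ### Finite infima and discounted stochastic matrices -/

section FiniteInfimum

variable {ι : Type*} [Finite ι] [Nonempty ι] {f g : ι → ℝ}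

lemma abs_iInf_sub_iInf_le {ε : ℝ} (h : ∀ i, |f i - g i| ≤ ε) : |(⨅ i, f i) - ⨅ i, g i| ≤ ε := by
  obtain ⟨i, hi⟩ := exists_eq_ciInf_of_finite (f := f)
  obtain ⟨j, hj⟩ := exists_eq_ciInf_of_finite (f := g)
  have h1 := ciInf_le (Set.finite_range f).bddBelow j
  have h2 := ciInf_le (Set.finite_range g).bddBelow i
  have h3 := abs_le.1 (h i)
  have h4 := abs_le.1 (h j)
  rw [abs_le]
  constructor <;> linarith

lemma abs_iInf_le_of_finite {K : ℝ} (h : ∀ i, |f i| ≤ K) : |⨅ i, f i| ≤ K := by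
  obtain ⟨i, hi⟩ := exists_eq_ciInf_of_finite (f := f)
  exact hi ▸ h i

end FiniteInfimum

section StochasticMatrix

variable {S : Type*} [Fintype S] [DecidableEq S] {Q : Matrix S S ℝ} {δ : ℝ}

lemma Matrix.abs_mulVec_le_of_mem_rowStochastic (hQ : Q ∈ Matrix.rowStochastic ℝ S) {v : S → ℝ}
    {K : ℝ} (hv : ∀ s, |v s| ≤ K) (s : S) : |Q.mulVec v s| ≤ K := by
  calc |Q.mulVec v s| = |∑ j, Q s j * v j| := rfl
    _ ≤ ∑ j, |Q s j * v j| := Finset.abs_sum_le_sum_abs _ _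
    _ ≤ ∑ j, Q s j * K := by
        refine Finset.sum_le_sum fun j _ => ?_
        rw [abs_mul, abs_of_nonneg (Matrix.nonneg_of_mem_rowStochastic hQ)]
        exact mul_le_mul_of_nonneg_left (hv j) (Matrix.nonneg_of_mem_rowStochastic hQ)
    _ = K := by rw [← Finset.sum_mul, Matrix.sum_row_of_mem_rowStochastic hQ, one_mul]

/-- Minimum principle: at a minimizer `m` of `u`, averaging gives `u m ≤ (Q u) m`, so `δ * u m ≤ u
m`, and `δ < 1` forces `u m ≥ 0`. All comparisons of policy values rest on this. -/
lemma Matrix.nonneg_of_discounted_mulVec_le (hQ : Q ∈ Matrix.rowStochastic ℝ S) (hδ0 : 0 ≤ δ)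
    (hδ1 : δ < 1) {u : S → ℝ} (hu : ∀ s, δ * Q.mulVec u s ≤ u s) (s : S) : 0 ≤ u s := by
  obtain ⟨m, -, hm⟩ := Finset.exists_min_image Finset.univ u ⟨s, Finset.mem_univ s⟩
  have h1 : u m ≤ Q.mulVec u m := by
    calc u m = ∑ j, Q m j * u m := by
          rw [← Finset.sum_mul, Matrix.sum_row_of_mem_rowStochastic hQ, one_mul]
      _ ≤ ∑ j, Q m j * u j := Finset.sum_le_sum fun j hj =>
          mul_le_mul_of_nonneg_left (hm j hj) (Matrix.nonneg_of_mem_rowStochastic hQ)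
      _ = Q.mulVec u m := rfl
  have h2 := mul_le_mul_of_nonneg_left h1 hδ0
  have h3 := hu m
  have h4 : 0 ≤ (1 - δ) * u m := by linarith
  have h5 : 0 ≤ u m := by
    by_contra hneg
    push Not at hneg
    nlinarith
  exact h5.trans (hm s (Finset.mem_univ s))

lemma Matrix.summable_discounted (hQ : Q ∈ Matrix.rowStochastic ℝ S) (hδ0 : 0 ≤ δ)
    (hδ1 : δ < 1) (c : S → ℝ) (s : S) : Summable fun t : ℕ => δ ^ t * (Q ^ t).mulVec c s := by
  refine Summable.of_norm_bounded (g := fun t => δ ^ t * ∑ j, |c j|)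
    ((summable_geometric_of_lt_one hδ0 hδ1).mul_right _) fun t => ?_
  rw [Real.norm_eq_abs, abs_mul, abs_of_nonneg (pow_nonneg hδ0 t)]
  refine mul_le_mul_of_nonneg_left ?_ (pow_nonneg hδ0 t)
  exact Matrix.abs_mulVec_le_of_mem_rowStochastic (pow_mem hQ t)
    (fun j => Finset.single_le_sum (f := fun j => |c j|) (fun i _ => abs_nonneg _)
      (Finset.mem_univ j)) s

/-- Slot zero is split off and one factor `Q` is pulled out of each remaining power. -/
lemma Matrix.tsum_discounted_eq (hQ : Q ∈ Matrix.rowStochastic ℝ S) (hδ0 : 0 ≤ δ)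
    (hδ1 : δ < 1) (c : S → ℝ) (s : S) :
    ∑' t : ℕ, δ ^ t * (Q ^ t).mulVec c s =
      c s + δ * Q.mulVec (fun s' => ∑' t : ℕ, δ ^ t * (Q ^ t).mulVec c s') s := by
  have hs := Matrix.summable_discounted hQ hδ0 hδ1 c
  rw [(hs s).tsum_eq_zero_add]
  congr 1
  · simp
  · change _ = δ * ∑ j, Q s j * ∑' t : ℕ, δ ^ t * (Q ^ t).mulVec c j
    simp_rw [← tsum_mul_left]
    rw [← Summable.tsum_finsetSum fun j _ => (hs j).mul_left _, ← tsum_mul_left]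
    refine tsum_congr fun t => ?_
    rw [pow_succ' Q, ← Matrix.mulVec_mulVec]
    change _ * ∑ j, Q s j * _ = _
    rw [Finset.mul_sum, Finset.mul_sum]
    exact Finset.sum_congr rfl fun j _ => by ring

end StochasticMatrix

/-! ### Dynamic programming for the edge system -/

namespace EdgeSystem

variable {L W E H G : Type*} [Fintype L] [Fintype W] [Fintype E] [Fintype H]
  [DecidableEq W] [DecidableEq E] [DecidableEq H] (M : EdgeSystem L W E H G)

lemma Pexo_mem_rowStochastic : M.Pexo ∈ Matrix.rowStochastic ℝ (W × E × H) := by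
  rw [Matrix.mem_rowStochastic_iff_sum]
  constructor
  · intro x y
    exact mul_nonneg (mul_nonneg (Matrix.nonneg_of_mem_rowStochastic M.PW_stochastic)
      (Matrix.nonneg_of_mem_rowStochastic M.PE_stochastic))
      (Matrix.nonneg_of_mem_rowStochastic M.PH_stochastic)
  · intro x
    simp only [EdgeParams.Pexo, Matrix.of_apply, Fintype.sum_prod_type]
    simp_rw [← Finset.mul_sum, Matrix.sum_row_of_mem_rowStochastic M.PH_stochastic, mul_one,
      ← Finset.mul_sum, Matrix.sum_row_of_mem_rowStochastic M.PE_stochastic, mul_one,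
      Matrix.sum_row_of_mem_rowStochastic M.PW_stochastic]

/-- Conditional expectation of `f` at the green power realization and the next exogenous state,
given the current exogenous state `x`. -/
def nextMean (x : W × E × H) (f : G → W × E × H → ℝ) : ℝ :=
  ∑ x', M.Pexo x x' * ∑' γ, M.Pg x.2.1 γ * f γ x'

variable {M}

lemma summable_Pg_mul {e : E} {f : G → ℝ} {K : ℝ} (hf : ∀ γ, |f γ| ≤ K) :
    Summable fun γ => M.Pg e γ * f γ := by
  refine Summable.of_norm_bounded (g := fun γ => M.Pg e γ * K)
    ((M.Pg_sum e).summable.mul_right _) fun γ => ?_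
  rw [Real.norm_eq_abs, abs_mul, abs_of_nonneg (M.Pg_nonneg e γ)]
  exact mul_le_mul_of_nonneg_left (hf γ) (M.Pg_nonneg e γ)

lemma nextMean_of_exo (x : W × E × H) (f : W × E × H → ℝ) :
    M.nextMean x (fun _ x' => f x') = M.Pexo.mulVec f x := by
  refine Finset.sum_congr rfl fun x' _ => ?_
  rw [tsum_mul_right, (M.Pg_sum _).tsum_eq, one_mul]

lemma nextMean_of_green (x : W × E × H) (f : G → ℝ) :
    M.nextMean x (fun γ _ => f γ) = ∑' γ, M.Pg x.2.1 γ * f γ := by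
  rw [nextMean, ← Finset.sum_mul, Matrix.sum_row_of_mem_rowStochastic M.Pexo_mem_rowStochastic,
    one_mul]

/-- Puts the kernel in the form of a conditional mean of an observable, to which the martingale
estimates apply. -/
lemma ptrans_eq_nextMean (p : M.PState) (s' : M.State) [DecidableEq M.State] :
    M.ptrans p s' = M.nextMean p.1 fun γ x' => if (x', M.nextBat p.2 γ) = s' then 1 else 0 := by
  classical
  rw [ptrans, nextMean]
  refine Eq.trans ?_ (Fintype.sum_eq_single s'.1 fun x' hx' => ?_).symm
  · congr 1
    refine tsum_congr fun γ => ?_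
    congr 1
    simp only [Prod.ext_iff, Subtype.ext_iff, nextBat, true_and, eq_comm]
  · have : ∀ γ, ((x', M.nextBat p.2 γ) : M.State) ≠ s' := fun γ h => hx' (congrArg Prod.fst h)
    simp only [this, if_false, mul_zero, tsum_zero]

lemma ptrans_nonneg (p : M.PState) (s' : M.State) : 0 ≤ M.ptrans p s' := by
  refine mul_nonneg (Matrix.nonneg_of_mem_rowStochastic M.Pexo_mem_rowStochastic)
    (tsum_nonneg fun γ => mul_nonneg (M.Pg_nonneg _ _) ?_)
  split_ifs <;> norm_num

lemma sum_ptrans_eq_one (p : M.PState) : ∑ s', M.ptrans p s' = 1 := by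
  classical
  have h1 : ∀ x' γ, ∑ s' : M.State, (if (x', M.nextBat p.2 γ) = s' then (1 : ℝ) else 0) = 1 :=
    fun x' γ => by simp
  have h2 : ∀ x', ∑ s' : M.State, ∑' γ, M.Pg p.1.2.1 γ *
      (if (x', M.nextBat p.2 γ) = s' then (1 : ℝ) else 0) = 1 := fun x' => by
    rw [← Summable.tsum_finsetSum fun s' _ => summable_Pg_mul (K := 1) fun γ => by
      split_ifs <;> simp]
    simp_rw [← Finset.mul_sum, h1, mul_one]
    exact (M.Pg_sum _).tsum_eq
  simp_rw [ptrans_eq_nextMean]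
  unfold nextMean
  rw [Finset.sum_comm]
  simp_rw [← Finset.mul_sum, h2, mul_one]
  exact Matrix.sum_row_of_mem_rowStochastic M.Pexo_mem_rowStochastic p.1

/-- Admissibility bounds `a` by the energy left after basic operation, so the truncations at zero
are inactive. This is what makes the post-decision state sufficient for predicting the next state.
-/
lemma nextLevel_eq (s : M.State) (a : M.Act s) {g : ℝ} (hg : 0 ≤ g) :
    M.nextLevel s.1.1 s.2.1 a.1 g = min (M.postLevel s.1.1 s.2.1 a.1 + g) M.cap := by
  have hb := M.bat_range _ s.2.2
  have ha := a.2.2.1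
  have hcap := hb.1.trans hb.2
  unfold EdgeParams.nextLevel EdgeParams.postLevel
  split_ifs with h
  · exact max_eq_left (le_min (add_nonneg hb.1 hg) hcap)
  · have h' : M.dop s.1.1 ≤ s.2.1 := not_lt.1 h
    rw [max_eq_left (sub_nonneg.2 h')] at ha
    rw [max_eq_left (sub_nonneg.2 ha)]
    exact max_eq_left (le_min (add_nonneg (sub_nonneg.2 ha) hg) hcap)

lemma trans_eq_ptrans_post (s : M.State) (a : M.Act s) (s' : M.State) :
    M.trans s a s' = M.ptrans (M.post s a) s' := by
  unfold trans ptrans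
  congr 1
  refine tsum_congr fun γ => ?_
  rw [nextLevel_eq s a (M.green_nonneg γ)]
  rfl

lemma policyMatrix_mem_rowStochastic [DecidableEq M.State] (π : M.Policy) :
    M.policyMatrix π ∈ Matrix.rowStochastic ℝ M.State := by
  rw [Matrix.mem_rowStochastic_iff_sum]
  constructor
  · intro s s'
    simp only [policyMatrix, Matrix.of_apply, trans_eq_ptrans_post]
    exact ptrans_nonneg _ _
  · intro s
    simp only [policyMatrix, Matrix.of_apply, trans_eq_ptrans_post]
    exact sum_ptrans_eq_one _

lemma policyMatrix_mulVec (π : M.Policy) (v : M.State → ℝ) (s : M.State) :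
    (M.policyMatrix π).mulVec v s = ∑ s', M.ptrans (M.post s (π s)) s' * v s' := by
  simp_rw [← trans_eq_ptrans_post]
  rfl

lemma discounted_eq (π : M.Policy) (c : M.State → ℝ) (s : M.State) :
    M.discounted π c s = c s + M.disc * (M.policyMatrix π).mulVec (M.discounted π c) s := by
  classical
  exact Matrix.tsum_discounted_eq (policyMatrix_mem_rowStochastic π) M.disc_nonneg M.disc_lt_one c s

/-- A subsolution of the policy equation lies below its solution: the minimum principle applies to
the difference. The companion `discounted_le` treats supersolutions. -/
lemma le_discounted (π : M.Policy) (c v : M.State → ℝ)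
    (h : ∀ s, v s ≤ c s + M.disc * (M.policyMatrix π).mulVec v s) (s : M.State) :
    v s ≤ M.discounted π c s := by
  classical
  have := Matrix.nonneg_of_discounted_mulVec_le (policyMatrix_mem_rowStochastic π) M.disc_nonneg
    M.disc_lt_one (u := M.discounted π c - v) (fun s => ?_) s
  · simpa using this
  · rw [Matrix.mulVec_sub, Pi.sub_apply, Pi.sub_apply, discounted_eq π c s]
    linarith [h s]

lemma discounted_le (π : M.Policy) (c v : M.State → ℝ)
    (h : ∀ s, c s + M.disc * (M.policyMatrix π).mulVec v s ≤ v s) (s : M.State) :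
    M.discounted π c s ≤ v s := by
  classical
  have := Matrix.nonneg_of_discounted_mulVec_le (policyMatrix_mem_rowStochastic π) M.disc_nonneg
    M.disc_lt_one (u := v - M.discounted π c) (fun s => ?_) s
  · simpa using this
  · rw [Matrix.mulVec_sub, Pi.sub_apply, Pi.sub_apply, discounted_eq π c s]
    linarith [h s]

lemma discounted_mono (π : M.Policy) {c c' : M.State → ℝ} (h : ∀ s, c s ≤ c' s) (s : M.State) :
    M.discounted π c s ≤ M.discounted π c' s := by
  refine le_discounted π c' _ (fun s => ?_) s
  rw [discounted_eq π c s]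
  linarith [h s]

lemma abs_ptrans_sum_le (p : M.PState) {v : M.State → ℝ} {K : ℝ} (hv : ∀ s, |v s| ≤ K) :
    |∑ s', M.ptrans p s' * v s'| ≤ K := by
  calc |∑ s', M.ptrans p s' * v s'| ≤ ∑ s', |M.ptrans p s' * v s'| :=
        Finset.abs_sum_le_sum_abs _ _
    _ ≤ ∑ s', M.ptrans p s' * K := by
        refine Finset.sum_le_sum fun s' _ => ?_
        rw [abs_mul, abs_of_nonneg (ptrans_nonneg p s')]
        exact mul_le_mul_of_nonneg_left (hv s') (ptrans_nonneg p s')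
    _ = K := by rw [← Finset.sum_mul, sum_ptrans_eq_one, one_mul]

variable (M) in
/-- The Bellman operator. -/
def bellman (v : M.State → ℝ) (s : M.State) : ℝ :=
  ⨅ a : M.Act s, (M.cost s a + M.disc * ∑ s', M.ptrans (M.post s a) s' * v s')

lemma bellman_contracting :
    ContractingWith M.disc.toNNReal M.bellman := by
  refine ⟨Real.toNNReal_lt_one.2 M.disc_lt_one, LipschitzWith.of_dist_le_mul ?_⟩
  intro v v'
  rw [dist_pi_le_iff (mul_nonneg (NNReal.coe_nonneg _) dist_nonneg)]
  intro s
  rw [Real.dist_eq, Real.coe_toNNReal _ M.disc_nonneg]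
  refine abs_iInf_sub_iInf_le fun a => ?_
  have : (M.cost s a + M.disc * ∑ s', M.ptrans (M.post s a) s' * v s')
      - (M.cost s a + M.disc * ∑ s', M.ptrans (M.post s a) s' * v' s')
      = M.disc * ∑ s', M.ptrans (M.post s a) s' * (v s' - v' s') := by
    simp_rw [mul_sub, Finset.sum_sub_distrib]
    ring
  rw [this, abs_mul, abs_of_nonneg M.disc_nonneg]
  refine mul_le_mul_of_nonneg_left (abs_ptrans_sum_le _ fun s' => ?_) M.disc_nonneg
  rw [← Real.dist_eq]
  exact dist_le_pi_dist v v' s'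

lemma exists_bellman_fixedPoint : ∃ v : M.State → ℝ, ∀ s, M.bellman v s = v s :=
  ⟨_, fun s => congrFun (bellman_contracting (M := M)).fixedPoint_isFixedPt s⟩

lemma le_value_of_bellman_fixedPoint {v : M.State → ℝ} (hv : ∀ s, M.bellman v s = v s)
    (π : M.Policy) (s : M.State) : v s ≤ M.value π s := by
  refine le_discounted π _ v (fun s => ?_) s
  rw [policyMatrix_mulVec, ← hv s]
  exact ciInf_le (Set.finite_range _).bddBelow (π s)

lemma value_eq_of_bellman_fixedPoint {v : M.State → ℝ} (hv : ∀ s, M.bellman v s = v s)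
    {π : M.Policy}
    (hπ : ∀ s (a : M.Act s), M.cost s (π s) + M.disc * ∑ s', M.ptrans (M.post s (π s)) s' * v s' ≤
      M.cost s a + M.disc * ∑ s', M.ptrans (M.post s a) s' * v s') (s : M.State) :
    M.value π s = v s := by
  refine le_antisymm (discounted_le π _ v (fun s => ?_) s) (le_value_of_bellman_fixedPoint hv π s)
  rw [policyMatrix_mulVec, ← hv s]
  exact le_ciInf (hπ s)

instance : Finite M.Policy := Pi.finite

/-- The Banach fixed point is a subsolution for every policy, hence below every policy value, and it
is attained by the policy selecting a minimizer in each state. So it is the infimum over policies.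
-/
lemma bellman_optValue (s : M.State) : M.bellman M.optValue s = M.optValue s := by
  obtain ⟨v, hv⟩ := exists_bellman_fixedPoint (M := M)
  have key : ∀ s, M.optValue s = v s := by
    choose π hπ using fun s => exists_eq_ciInf_of_finite
      (f := fun a : M.Act s => M.cost s a + M.disc * ∑ s', M.ptrans (M.post s a) s' * v s')
    intro s
    refine le_antisymm ?_ (le_ciInf fun π => le_value_of_bellman_fixedPoint hv π s)
    rw [← value_eq_of_bellman_fixedPoint hv (π := π) (fun s a => ?_) s]
    · exact ciInf_le (Set.finite_range _).bddBelow π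
    · rw [hπ s]
      exact ciInf_le (Set.finite_range _).bddBelow a
  rw [show M.optValue = v from funext key]
  exact hv s

lemma optValue_eq_iInf (s : M.State) :
    M.optValue s = ⨅ a : M.Act s, (M.cost s a + M.disc * M.optPValue (M.post s a)) :=
  (bellman_optValue s).symm

lemma value_eq_optValue_of_greedy {π : M.Policy}
    (hπ : ∀ s (a : M.Act s), M.cost s (π s) + M.disc * M.optPValue (M.post s (π s)) ≤
      M.cost s a + M.disc * M.optPValue (M.post s a)) (s : M.State) :
    M.value π s = M.optValue s :=
  value_eq_of_bellman_fixedPoint bellman_optValue hπ s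

lemma optValue_le_value (π : M.Policy) (s : M.State) : M.optValue s ≤ M.value π s :=
  ciInf_le (Set.finite_range _).bddBelow π

lemma cdelayOpt_le (s : M.State) (a : M.Act s) {p : ℕ × ℝ}
    (hp : p ∈ M.controls s.1.1 s.2.1 a.1) :
    M.cdelayOpt s a ≤ M.cdelay s.1.2.2 s.1.1 p := by
  obtain ⟨q, -, hq⟩ := M.exists_control s.1.2.2 s.1.1 s.2.1 s.2.2 a.1 a.2
  refine csInf_le ⟨M.cdelay s.1.2.2 s.1.1 q, ?_⟩ ⟨p, hp, rfl⟩
  rintro _ ⟨r, hr, rfl⟩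
  exact hq r hr

lemma cdelayOpt_eq {s : M.State} {a : M.Act s} {p : ℕ × ℝ} (hp : M.IsOptControl s a p) :
    M.cdelayOpt s a = M.cdelay s.1.2.2 s.1.1 p := by
  refine le_antisymm (cdelayOpt_le s a hp.1) (le_csInf ⟨_, p, hp.1, rfl⟩ ?_)
  rintro _ ⟨r, hr, rfl⟩
  exact hp.2 r hr

lemma jointValue_eq_value {π : M.Policy} {u : M.State → ℕ × ℝ}
    (hu : ∀ s, M.IsOptControl s (π s) (u s)) (s : M.State) :
    M.jointValue π u s = M.value π s := by
  unfold jointValue value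
  congr 1
  funext s
  rw [jointCost, cost, cdelayOpt_eq (hu s)]

lemma value_le_jointValue {π : M.Policy} {u : M.State → ℕ × ℝ}
    (hu : ∀ s, u s ∈ M.controls s.1.1 s.2.1 (π s).1) (s : M.State) :
    M.value π s ≤ M.jointValue π u s := by
  refine discounted_mono π (fun s => ?_) s
  rw [jointCost, cost]
  linarith [cdelayOpt_le s (π s) (hu s)]

/-- A strict inequality between two limiting costs-to-go eventually holds for the estimates too, and
there are only finitely many such inequalities. Hence an action greedy for late estimates cannot be
strictly suboptimal. -/
lemma recoversPolicy_of_tendsto {X : ℕ → M.Estimates}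
    (hV : ∀ p, Tendsto (fun t => (X t).V p) atTop (𝓝 (M.optPValue p)))
    (hc : ∀ s a, Tendsto (fun t => (X t).c s a) atTop (𝓝 (M.cost s a))) :
    M.RecoversPolicy X := by
  have hq : ∀ s (a : M.Act s), Tendsto (fun t => (X t).c s a + M.disc * (X t).V (M.post s a)) atTop
      (𝓝 (M.cost s a + M.disc * M.optPValue (M.post s a))) := fun s a =>
    (hc s a).add ((hV _).const_mul _)
  have hev : ∀ᶠ t in atTop, ∀ s, ∀ a a' : M.Act s,
      M.cost s a' + M.disc * M.optPValue (M.post s a') <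
        M.cost s a + M.disc * M.optPValue (M.post s a) →
      (X t).c s a' + M.disc * (X t).V (M.post s a') <
        (X t).c s a + M.disc * (X t).V (M.post s a) := by
    simp only [eventually_all]
    intro s a a' h
    exact (hq s a').eventually_lt (hq s a) h
  filter_upwards [hev] with t ht π hπ
  have hval : ∀ s, M.value π s = M.optValue s := value_eq_optValue_of_greedy fun s a => by
    by_contra hlt
    exact absurd (ht s _ _ (not_le.1 hlt)) (not_lt.2 (hπ s a))
  refine ⟨hval, fun u hu π' u' hu' s => ?_⟩
  rw [jointValue_eq_value hu, hval]
  exact (optValue_le_value π' s).trans (value_le_jointValue hu' s)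

end EdgeSystem

end

/-! ### Deterministic Robbins-Monro recursions -/

noncomputable section

section StochasticApproximation

/-- As `1 - β ≤ exp (-β)`, the sequence is dominated by a constant times `exp (-∑ β)`, which tends
to zero. -/
lemma eventually_le_of_le_one_sub_mul {d β : ℕ → ℝ}
    (hβ1 : Tendsto (fun n => ∑ t ∈ Finset.range n, β t) atTop atTop)
    (hd : ∀ᶠ t in atTop, β t ≤ 1 ∧ d (t + 1) ≤ (1 - β t) * d t) {ε : ℝ} (hε : 0 < ε) :
    ∀ᶠ t in atTop, d t ≤ ε := by
  obtain ⟨T, hT⟩ := eventually_atTop.1 hd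
  have hbound : ∀ t ≥ T, d t ≤ |d T| * Real.exp (∑ k ∈ Finset.range T, β k) *
      Real.exp (-∑ k ∈ Finset.range t, β k) := by
    intro t ht
    induction t, ht using Nat.le_induction with
    | base =>
      rw [mul_assoc, ← Real.exp_add, add_neg_cancel, Real.exp_zero, mul_one]
      exact le_abs_self _
    | succ t ht ih =>
      obtain ⟨h1, h2⟩ := hT t ht
      rw [Finset.sum_range_succ, neg_add, Real.exp_add]
      calc d (t + 1) ≤ (1 - β t) * d t := h2
        _ ≤ (1 - β t) * (|d T| * Real.exp (∑ k ∈ Finset.range T, β k) *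
            Real.exp (-∑ k ∈ Finset.range t, β k)) :=
          mul_le_mul_of_nonneg_left ih (sub_nonneg.2 h1)
        _ ≤ Real.exp (-β t) * (|d T| * Real.exp (∑ k ∈ Finset.range T, β k) *
            Real.exp (-∑ k ∈ Finset.range t, β k)) :=
          mul_le_mul_of_nonneg_right (Real.one_sub_le_exp_neg _) (by positivity)
        _ = _ := by ring
  have hlim : Tendsto (fun t => |d T| * Real.exp (∑ k ∈ Finset.range T, β k) *
      Real.exp (-∑ k ∈ Finset.range t, β k)) atTop (𝓝 0) := by
    simpa using (Real.tendsto_exp_neg_atTop_nhds_zero.comp hβ1).const_mul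
      (|d T| * Real.exp (∑ k ∈ Finset.range T, β k))
  filter_upwards [hlim.eventually (eventually_le_nhds hε), eventually_ge_atTop T] with t h1 h2
  exact (hbound t h2).trans h1

/-- A Robbins-Monro recursion with asymptotically bounded drift target `r` and summable noise `z`
is eventually as small as the target. -/
lemma eventually_abs_le_of_robbinsMonro {Y β r z : ℕ → ℝ} {u ε l : ℝ} (hβ0 : ∀ t, 0 ≤ β t)
    (hβ : Tendsto β atTop (𝓝 0))
    (hβ1 : Tendsto (fun n => ∑ t ∈ Finset.range n, β t) atTop atTop)
    (hz : Tendsto (fun n => ∑ t ∈ Finset.range n, z t) atTop (𝓝 l))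
    (hY : ∀ t, Y (t + 1) = (1 - β t) * Y t + β t * r t + z t)
    (hr : ∀ᶠ t in atTop, |r t| ≤ u) (hε : 0 < ε) :
    ∀ᶠ t in atTop, |Y t| ≤ u + ε := by
  -- `R` is minus the tail of the noise series, so it vanishes in the limit. `Y - R` obeys a
  -- noiseless recursion with target `r - R`. The three parts of `ε` pay for the perturbed target,
  -- the decaying excess, and adding `R` back.
  set R : ℕ → ℝ := fun n => ∑ t ∈ Finset.range n, z t - l with hR
  have hR0 : Tendsto R atTop (𝓝 0) := by simpa [hR] using hz.sub_const l
  have hRε : ∀ᶠ t in atTop, |R t| ≤ ε / 3 :=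
    (by simpa using hR0.abs : Tendsto (fun t => |R t|) atTop (𝓝 0)).eventually
      (eventually_le_nhds (by positivity))
  have hRs : ∀ t, R (t + 1) = R t + z t := fun t => by
    simp only [hR, Finset.sum_range_succ]; ring
  have hU : ∀ᶠ t in atTop, |Y t - R t| - (u + ε / 3) ≤ ε / 3 := by
    refine eventually_le_of_le_one_sub_mul hβ1 ?_ (by positivity)
    filter_upwards [hr, hRε, hβ.eventually (eventually_le_nhds one_pos)] with t h1 h2 h3
    refine ⟨h3, ?_⟩
    have h4 : Y (t + 1) - R (t + 1) = (1 - β t) * (Y t - R t) + β t * (r t - R t) := by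
      rw [hY, hRs]; ring
    have h5 : |r t - R t| ≤ u + ε / 3 := (abs_sub _ _).trans (add_le_add h1 h2)
    have h6 : |(1 - β t) * (Y t - R t) + β t * (r t - R t)| ≤
        (1 - β t) * |Y t - R t| + β t * |r t - R t| := by
      refine (abs_add_le _ _).trans ?_
      rw [abs_mul, abs_mul, abs_of_nonneg (sub_nonneg.2 h3), abs_of_nonneg (hβ0 t)]
    rw [h4]
    have h7 := mul_le_mul_of_nonneg_left h5 (hβ0 t)
    linarith
  filter_upwards [hU, hRε] with t h1 h2
  have h3 : |Y t| ≤ |Y t - R t| + |R t| := by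
    simpa using abs_add_le (Y t - R t) (R t)
  linarith

end StochasticApproximation

/-! ### Almost sure convergence of martingale difference series -/

section MartingaleDifferences

variable {Ω : Type*} {mΩ : MeasurableSpace Ω} {P : Measure Ω} [IsProbabilityMeasure P]
  {ℱ : Filtration ℕ mΩ} {d : ℕ → Ω → ℝ} {a : ℕ → ℝ}

/-- Increments are orthogonal: the cross term vanishes on conditioning on `ℱ n`, which makes the
partial sum a constant factor. -/
lemma integral_sq_sum_le_of_condExp_eq_zero (hd : ∀ n, StronglyMeasurable[ℱ (n + 1)] (d n))
    (hbd : ∀ n ω, |d n ω| ≤ a n) (h0 : ∀ n, P[d n | ℱ n] =ᵐ[P] 0)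
    (hM : ∀ n, StronglyMeasurable[ℱ n] (fun ω => ∑ t ∈ Finset.range n, d t ω))
    (hMb : ∀ n ω, |∑ t ∈ Finset.range n, d t ω| ≤ ∑ t ∈ Finset.range n, a t) (n : ℕ) :
    ∫ ω, (∑ t ∈ Finset.range n, d t ω) ^ 2 ∂P ≤ ∑ t ∈ Finset.range n, a t ^ 2 := by
  induction n with
  | zero => simp
  | succ n ih =>
    set m : Ω → ℝ := fun ω => ∑ t ∈ Finset.range n, d t ω with hm
    have hmm : AEStronglyMeasurable m P := ((hM n).mono (ℱ.le n)).aestronglyMeasurable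
    have hdm : AEStronglyMeasurable (d n) P := ((hd n).mono (ℱ.le _)).aestronglyMeasurable
    have hdi : Integrable (d n) P := .of_bound hdm (a n) (ae_of_all _ (hbd n))
    have hmi : Integrable m P := .of_bound hmm _ (ae_of_all _ (hMb n))
    have hmdi : Integrable (m * d n) P := hdi.bdd_mul hmm (ae_of_all _ (hMb n))
    have hm2 : Integrable (fun ω => m ω ^ 2) P := by
      simpa [sq] using hmi.bdd_mul hmm (ae_of_all _ (hMb n))
    have hd2 : Integrable (fun ω => d n ω ^ 2) P := by
      simpa [sq] using hdi.bdd_mul hdm (ae_of_all _ (hbd n))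
    have hmd2 : Integrable (fun ω => 2 * (m ω * d n ω)) P := hmdi.const_mul 2
    have hcross : ∫ ω, m ω * d n ω ∂P = 0 := by
      have h1 : P[m * d n | ℱ n] =ᵐ[P] m * P[d n | ℱ n] :=
        condExp_mul_of_stronglyMeasurable_left (hM n) hmdi hdi
      have h2 : P[m * d n | ℱ n] =ᵐ[P] 0 := by
        filter_upwards [h1, h0 n] with ω h3 h4
        simp [h3, h4]
      calc ∫ ω, m ω * d n ω ∂P = ∫ ω, (P[m * d n | ℱ n]) ω ∂P :=
            (integral_condExp (ℱ.le n)).symm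
        _ = 0 := by rw [integral_congr_ae h2]; simp
    have hexp : ∀ ω, (∑ t ∈ Finset.range (n + 1), d t ω) ^ 2 =
        m ω ^ 2 + 2 * (m ω * d n ω) + d n ω ^ 2 := fun ω => by
      rw [Finset.sum_range_succ]; ring
    simp_rw [hexp]
    rw [integral_add (f := fun ω => m ω ^ 2 + 2 * (m ω * d n ω)) (hm2.add hmd2) hd2,
      integral_add hm2 hmd2,
      integral_const_mul, hcross, mul_zero, add_zero, Finset.sum_range_succ]
    refine add_le_add ih ?_
    calc ∫ ω, d n ω ^ 2 ∂P ≤ ∫ _, a n ^ 2 ∂P :=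
          integral_mono hd2 (integrable_const _) fun ω => sq_le_sq' (abs_le.1 (hbd n ω)).1
            (abs_le.1 (hbd n ω)).2
      _ = a n ^ 2 := by simp

/-- A series of martingale differences with square summable bounds converges almost everywhere. -/
lemma ae_exists_tendsto_sum_of_condExp_eq_zero
    (hd : ∀ n, StronglyMeasurable[ℱ (n + 1)] (d n))
    (hbd : ∀ n ω, |d n ω| ≤ a n) (ha : Summable fun n => a n ^ 2)
    (h0 : ∀ n, P[d n | ℱ n] =ᵐ[P] 0) :
    ∀ᵐ ω ∂P, ∃ l, Tendsto (fun n => ∑ t ∈ Finset.range n, d t ω) atTop (𝓝 l) := by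
  have hM : ∀ n, StronglyMeasurable[ℱ n] (fun ω => ∑ t ∈ Finset.range n, d t ω) := fun n =>
    Finset.stronglyMeasurable_fun_sum _ fun t ht =>
      (hd t).mono (ℱ.mono (Nat.succ_le_of_lt (Finset.mem_range.1 ht)))
  have hMb : ∀ n ω, |∑ t ∈ Finset.range n, d t ω| ≤ ∑ t ∈ Finset.range n, a t := fun n ω =>
    (Finset.abs_sum_le_sum_abs _ _).trans (Finset.sum_le_sum fun t _ => hbd t ω)
  have hMi : ∀ n, Integrable (fun ω => ∑ t ∈ Finset.range n, d t ω) P := fun n =>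
    .of_bound ((hM n).mono (ℱ.le n)).aestronglyMeasurable _ (ae_of_all _ (hMb n))
  have hmart : Martingale (fun n ω => ∑ t ∈ Finset.range n, d t ω) ℱ P := by
    refine martingale_of_condExp_sub_eq_zero_nat hM hMi fun n => ?_
    have : ((fun ω => ∑ t ∈ Finset.range (n + 1), d t ω) - fun ω => ∑ t ∈ Finset.range n, d t ω) =
        d n := by
      funext ω
      simp [Finset.sum_range_succ]
    rw [this]
    exact h0 n
  -- Doob's theorem needs only an L¹ bound; it follows from the L² bound through `|y| ≤ 1 + y ^ 2`.
  refine hmart.submartingale.exists_ae_tendsto_of_bdd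
    (R := (1 + ∑' n, a n ^ 2).toNNReal) fun n => ?_
  rw [eLpNorm_one_eq_lintegral_enorm, ← ofReal_integral_norm_eq_lintegral_enorm (hMi n)]
  refine ENNReal.ofReal_le_ofReal ?_
  have hsq : Integrable (fun ω => (∑ t ∈ Finset.range n, d t ω) ^ 2) P := by
    simpa [sq] using (hMi n).bdd_mul ((hM n).mono (ℱ.le n)).aestronglyMeasurable
      (ae_of_all _ (hMb n))
  calc ∫ ω, ‖∑ t ∈ Finset.range n, d t ω‖ ∂P
      ≤ ∫ ω, (1 + (∑ t ∈ Finset.range n, d t ω) ^ 2) ∂P := by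
        refine integral_mono (hMi n).norm ((integrable_const _).add hsq) fun ω => ?_
        simp only [Real.norm_eq_abs]
        nlinarith [sq_abs (∑ t ∈ Finset.range n, d t ω),
          sq_nonneg (|∑ t ∈ Finset.range n, d t ω| - 1),
          abs_nonneg (∑ t ∈ Finset.range n, d t ω)]
    _ = 1 + ∫ ω, (∑ t ∈ Finset.range n, d t ω) ^ 2 ∂P := by
        rw [integral_add (integrable_const _) hsq]; simp
    _ ≤ 1 + ∑ t ∈ Finset.range n, a t ^ 2 :=
        add_le_add le_rfl (integral_sq_sum_le_of_condExp_eq_zero hd hbd h0 hM hMb n)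
    _ ≤ 1 + ∑' n, a n ^ 2 :=
        add_le_add le_rfl (ha.sum_le_tsum _ fun i _ => sq_nonneg _)

end MartingaleDifferences

end

/-! ### Conditional law and noise series of a run -/

noncomputable section

/-- Preimages are countable unions of level sets of `u`, so no σ-algebra on the value space is
needed. -/
lemma stronglyMeasurable_of_countable_factor {Ω K : Type*} {m : MeasurableSpace Ω} [Countable K]
    {u : Ω → K} (hu : ∀ k, MeasurableSet[m] {ω | u ω = k}) {F : Ω → ℝ}
    (hF : ∀ ω ω', u ω = u ω' → F ω = F ω') : StronglyMeasurable[m] F := by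
  refine Measurable.stronglyMeasurable fun U _ => ?_
  have : F ⁻¹' U = ⋃ k ∈ u '' (F ⁻¹' U), {ω | u ω = k} := by
    ext ω
    simp only [Set.mem_iUnion, Set.mem_image, Set.mem_ofPred_eq, exists_prop]
    constructor
    · intro h
      exact ⟨u ω, ⟨ω, h, rfl⟩, rfl⟩
    · rintro ⟨k, ⟨ω', h, h1⟩, h2⟩
      have := hF ω ω' (h2.trans h1.symm)
      rwa [Set.mem_preimage, this]
  rw [this]
  exact MeasurableSet.biUnion (Set.to_countable _) fun k _ => hu k

namespace EdgeSystem

variable {L W E H G : Type*} [Fintype L] [Fintype W] [Fintype E] [Fintype H]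
  [DecidableEq W] [DecidableEq E] [DecidableEq H] {M : EdgeSystem L W E H G}
  {Ω : Type*} [mΩ : MeasurableSpace Ω] {P : Measure Ω} {ℱ : Filtration ℕ mΩ} {ρ α : ℕ → ℝ}
  {X₀ : M.Estimates} {S : ℕ → Ω → M.State} {A : (t : ℕ) → (ω : Ω) → M.Act (S t ω)}
  {Γ : ℕ → Ω → G}

namespace IsRun

lemma measurableSet_exo (hrun : M.IsRun P ℱ ρ α X₀ S A Γ) (t : ℕ) (x : W × E × H) :
    MeasurableSet[ℱ t] {ω | (S t ω).1 = x} := by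
  have : {ω | (S t ω).1 = x} = ⋃ b, {ω | S t ω = (x, b)} := by
    ext ω
    simp [Prod.ext_iff]
  rw [this]
  exact MeasurableSet.iUnion fun b => hrun.state_meas t _

lemma measurableSet_next (hrun : M.IsRun P ℱ ρ α X₀ S A Γ) (t : ℕ) (γ : G) (x : W × E × H) :
    MeasurableSet[ℱ (t + 1)] {ω | Γ t ω = γ ∧ (S (t + 1) ω).1 = x} :=
  (hrun.green_meas t γ).inter (hrun.measurableSet_exo (t + 1) x)

lemma stronglyMeasurable_exo (hrun : M.IsRun P ℱ ρ α X₀ S A Γ) (t : ℕ) (f : W × E × H → ℝ) :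
    StronglyMeasurable[ℱ t] fun ω => f (S t ω).1 :=
  stronglyMeasurable_of_countable_factor (hrun.measurableSet_exo t) fun _ _ h => by rw [h]

variable [Countable G]

lemma stronglyMeasurable_next (hrun : M.IsRun P ℱ ρ α X₀ S A Γ) (t : ℕ)
    (f : G → W × E × H → ℝ) :
    StronglyMeasurable[ℱ (t + 1)] fun ω => f (Γ t ω) (S (t + 1) ω).1 := by
  refine stronglyMeasurable_of_countable_factor (u := fun ω => (Γ t ω, (S (t + 1) ω).1))
    (fun k => ?_) fun ω ω' h => ?_
  · simpa only [Prod.ext_iff] using hrun.measurableSet_next t k.1 k.2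
  · simp only [Prod.mk.injEq] at h
    rw [h.1, h.2]

variable [IsProbabilityMeasure P]

/-- The law of a run prescribes conditional probabilities of atoms only. The observable is expanded
over the countably many atoms; the expansion commutes with conditional expectation because the atoms
are disjoint and `f` is bounded. -/
lemma condExp_next (hrun : M.IsRun P ℱ ρ α X₀ S A Γ) {f : G → W × E × H → ℝ} {K : ℝ}
    (hf : ∀ γ x, |f γ x| ≤ K) (t : ℕ) :
    P[fun ω => f (Γ t ω) (S (t + 1) ω).1 | ℱ t] =ᵐ[P] fun ω => M.nextMean (S t ω).1 f := by
  classical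
  set D : W × E × H → G → Set Ω := fun x γ => {ω | Γ t ω = γ ∧ (S (t + 1) ω).1 = x} with hD
  set F : W × E × H → G → Ω → ℝ := fun x γ => f γ x • (D x γ).indicator fun _ => (1 : ℝ) with hF
  have hDm : ∀ x γ, MeasurableSet (D x γ) := fun x γ =>
    ℱ.le (t + 1) _ (hrun.measurableSet_next t γ x)
  have hFm : ∀ x γ, StronglyMeasurable (F x γ) := fun x γ =>
    (stronglyMeasurable_const.indicator (hDm x γ)).const_smul _
  have hFb : ∀ x γ ω, ‖F x γ ω‖ ≤ K := fun x γ ω => by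
    simp only [hF, Pi.smul_apply, smul_eq_mul, Set.indicator_apply, Real.norm_eq_abs]
    split_ifs
    · simpa using hf γ x
    · simpa using (abs_nonneg _).trans (hf γ x)
  have hsum : ∀ x, ∑' γ, ∫⁻ ω, ‖F x γ ω‖ₑ ∂P ≠ ⊤ := by
    intro x
    have hle : ∀ γ, ∫⁻ ω, ‖F x γ ω‖ₑ ∂P ≤ ENNReal.ofReal K * P (D x γ) := by
      intro γ
      rw [← lintegral_indicator_const (hDm x γ)]
      refine lintegral_mono fun ω => ?_
      simp only [hF, Pi.smul_apply, smul_eq_mul, Set.indicator_apply]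
      split_ifs
      · rw [mul_one, Real.enorm_eq_ofReal_abs]
        exact ENNReal.ofReal_le_ofReal (hf γ x)
      · simp
    refine ne_top_of_le_ne_top ?_ (ENNReal.tsum_le_tsum hle)
    rw [ENNReal.tsum_mul_left]
    refine ENNReal.mul_ne_top ENNReal.ofReal_ne_top ?_
    rw [← measure_iUnion _ (hDm x)]
    · exact measure_ne_top _ _
    · intro γ γ' hne
      rw [Function.onFun, Set.disjoint_left]
      rintro ω ⟨h1, -⟩ ⟨h2, -⟩
      exact hne (h1.symm.trans h2)
  have hpt : (fun ω => f (Γ t ω) (S (t + 1) ω).1) = ∑ x, fun ω => ∑' γ, F x γ ω := by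
    funext ω
    rw [Finset.sum_apply, Fintype.sum_eq_single (S (t + 1) ω).1, tsum_eq_single (Γ t ω)]
    · simp [hF, hD]
    · intro γ hγ
      simp [hF, hD, hγ.symm]
    · intro x hx
      simp [hF, hD, hx.symm]
  have hint : ∀ x, Integrable (fun ω => ∑' γ, F x γ ω) P := by
    intro x
    have heq : (fun ω => ∑' γ, F x γ ω) =
        fun ω => if (S (t + 1) ω).1 = x then f (Γ t ω) x else 0 := by
      funext ω
      split_ifs with h
      · rw [tsum_eq_single (Γ t ω)]
        · simp [hF, hD, h]
        · intro γ hγ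
          simp [hF, hD, hγ.symm]
      · simp [hF, hD, h]
    rw [heq]
    refine .of_bound (((hrun.stronglyMeasurable_next t
      (fun γ x' => if x' = x then f γ x else 0)).mono (ℱ.le _)).aestronglyMeasurable) K
      (ae_of_all _ fun ω => ?_)
    rw [Real.norm_eq_abs]
    split_ifs
    · exact hf _ _
    · simpa using (abs_nonneg _).trans (hf (Γ t ω) x)
  rw [hpt]
  have h1 := condExp_finsetSum (μ := P) (s := Finset.univ) (fun x _ => hint x) (ℱ t)
  have h2 : ∀ᵐ ω ∂P, ∀ x, (P[fun ω => ∑' γ, F x γ ω | ℱ t]) ω =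
      ∑' γ, (P[F x γ | ℱ t]) ω := ae_all_iff.2 fun x =>
    condExp_tsum (fun γ => (hFm x γ).aestronglyMeasurable) (hsum x)
  have h3 : ∀ᵐ ω ∂P, ∀ x γ, (P[F x γ | ℱ t]) ω =
      f γ x * (M.Pg (S t ω).1.2.1 γ * M.Pexo (S t ω).1 x) := by
    refine ae_all_iff.2 fun x => ae_all_iff.2 fun γ => ?_
    filter_upwards [condExp_smul (μ := P) (f γ x) ((D x γ).indicator fun _ => (1 : ℝ)) (ℱ t),
      hrun.law t γ x] with ω h4 h5
    rw [h4, Pi.smul_apply, h5, smul_eq_mul]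
  filter_upwards [h1, h2, h3] with ω h4 h5 h6
  rw [h4, Finset.sum_apply, nextMean]
  refine Finset.sum_congr rfl fun x _ => ?_
  rw [h5, ← tsum_mul_left]
  refine tsum_congr fun γ => ?_
  rw [h6]
  ring

/-- Weighted sums of the deviations of `f` from its conditional expectation converge almost surely
if the weights are predictable with square summable bounds. -/
lemma ae_exists_tendsto_sum_deviation (hrun : M.IsRun P ℱ ρ α X₀ S A Γ)
    {f : G → W × E × H → ℝ} {K : ℝ} (hf : ∀ γ x, |f γ x| ≤ K) {h : ℕ → Ω → ℝ} {a : ℕ → ℝ}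
    (hh : ∀ t, StronglyMeasurable[ℱ t] (h t)) (hha : ∀ t ω, |h t ω| ≤ a t)
    (ha : Summable fun t => a t ^ 2) :
    ∀ᵐ ω ∂P, ∃ l, Tendsto (fun n => ∑ t ∈ Finset.range n,
      h t ω * (f (Γ t ω) (S (t + 1) ω).1 - M.nextMean (S t ω).1 f)) atTop (𝓝 l) := by
  have hmean : ∀ x, |M.nextMean x f| ≤ K := by
    intro x
    have hQ := M.Pexo_mem_rowStochastic
    refine Matrix.abs_mulVec_le_of_mem_rowStochastic hQ
      (v := fun x' => ∑' γ, M.Pg x.2.1 γ * f γ x') (fun x' => ?_) x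
    have hs := summable_Pg_mul (M := M) (e := x.2.1) (f := fun γ => f γ x') fun γ => hf γ x'
    have hK : HasSum (fun γ => M.Pg x.2.1 γ * K) K := by
      simpa using (M.Pg_sum x.2.1).mul_right K
    refine (norm_tsum_le_tsum_norm hs.norm).trans (hK.tsum_eq ▸ hs.norm.tsum_le_tsum (fun γ => ?_)
      hK.summable)
    rw [norm_mul, Real.norm_of_nonneg (M.Pg_nonneg _ _)]
    exact mul_le_mul_of_nonneg_left (hf γ x') (M.Pg_nonneg _ _)
  have hdm : ∀ t, StronglyMeasurable[ℱ (t + 1)] fun ω =>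
      f (Γ t ω) (S (t + 1) ω).1 - M.nextMean (S t ω).1 f := fun t =>
    (hrun.stronglyMeasurable_next t f).sub
      ((hrun.stronglyMeasurable_exo t fun x => M.nextMean x f).mono (ℱ.mono t.le_succ))
  have hdb : ∀ t ω, |f (Γ t ω) (S (t + 1) ω).1 - M.nextMean (S t ω).1 f| ≤ K + K := fun t ω =>
    (abs_sub _ _).trans (add_le_add (hf _ _) (hmean _))
  refine ae_exists_tendsto_sum_of_condExp_eq_zero (ℱ := ℱ) (a := fun t => a t * (K + K))
    (fun t => ((hh t).mono (ℱ.mono t.le_succ)).mul (hdm t)) (fun t ω => ?_) ?_ fun t => ?_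
  · rw [abs_mul]
    exact mul_le_mul (hha t ω) (hdb t ω) (abs_nonneg _) ((abs_nonneg _).trans (hha t ω))
  · simpa only [mul_pow] using ha.mul_right _
  · have hfi : Integrable (fun ω => f (Γ t ω) (S (t + 1) ω).1) P :=
      .of_bound ((hrun.stronglyMeasurable_next t f).mono (ℱ.le _)).aestronglyMeasurable K
        (ae_of_all _ fun ω => hf _ _)
    have hgi : Integrable (fun ω => M.nextMean (S t ω).1 f) P :=
      .of_bound ((hrun.stronglyMeasurable_exo t fun x => M.nextMean x f).mono
        (ℱ.le _)).aestronglyMeasurable K (ae_of_all _ fun ω => hmean _)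
    have h1 := condExp_stronglyMeasurable_mul_of_bound (ℱ.le t) (hh t) (hfi.sub hgi) (a t)
      (ae_of_all _ (hha t))
    have h2 := condExp_of_stronglyMeasurable (ℱ.le t)
      (hrun.stronglyMeasurable_exo t fun x => M.nextMean x f) hgi
    filter_upwards [h1, condExp_sub hfi hgi (ℱ t), hrun.condExp_next hf t] with ω h3 h4 h5
    refine h3.trans ?_
    rw [Pi.mul_apply, h4, Pi.sub_apply, h5, h2, sub_self, mul_zero, Pi.zero_apply]

end IsRun

end EdgeSystem

end

/-! ### Predictability and uniform boundedness of the estimates -/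

noncomputable section

namespace EdgeSystem

variable {L W E H G : Type*} [Fintype L] [Fintype W] [Fintype E] [Fintype H]
  [DecidableEq W] [DecidableEq E] [DecidableEq H] {M : EdgeSystem L W E H G}
  {ρ α : ℕ → ℝ} {X₀ : M.Estimates}

/-- The green power may be unbounded, but it is nonnegative, so the depreciation term never exceeds
`omega * a`. -/
lemma exists_costG_bound : ∃ K, 0 ≤ K ∧ ∀ s (a : M.Act s) γ, |M.costG s a γ| ≤ K := by
  set B : (Σ s, M.Act s) → ℝ := fun q =>
    |M.cdelayOpt q.1 q.2| + (|M.phi * M.dop q.1.1.1| + M.omega * q.2.1) with hB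
  obtain ⟨K, hK⟩ := (Set.finite_range B).bddAbove
  refine ⟨max K 0, le_max_right _ _, fun s a γ => le_max_of_le_left ?_⟩
  refine le_trans ?_ (hK ⟨⟨s, a⟩, rfl⟩)
  refine (abs_add_le _ _).trans (add_le_add le_rfl ?_)
  have ha : 0 ≤ a.1 := M.act_nonneg _ a.2.1
  have hω := M.omega_pos
  unfold powerCost
  split_ifs
  · exact le_add_of_nonneg_right (mul_nonneg hω.le ha)
  · rw [abs_of_nonneg (mul_nonneg hω.le (le_max_right _ _))]
    refine le_add_of_nonneg_of_le (abs_nonneg _) (mul_le_mul_of_nonneg_left ?_ hω.le)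
    exact max_le (sub_le_self _ (M.green_nonneg γ)) ha

/-- The green power law depends on the environment component alone, so one observation is unbiased
for every state sharing that component. This justifies the batch update. -/
lemma nextMean_costG {s : M.State} (a : M.Act s) {x : W × E × H} (hx : s.1.2.1 = x.2.1) :
    M.nextMean x (fun γ _ => M.costG s a γ) = M.cost s a := by
  obtain ⟨K, -, hK⟩ := exists_costG_bound (M := M)
  have hp : Summable fun γ => M.Pg x.2.1 γ * M.powerCost s a.1 (M.green γ) := by
    refine summable_Pg_mul (K := K + |M.cdelayOpt s a|) fun γ => ?_
    have h1 : M.powerCost s a.1 (M.green γ) = M.costG s a γ - M.cdelayOpt s a := by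
      rw [costG]; ring
    rw [h1]
    exact (abs_sub _ _).trans (add_le_add (hK s a γ) le_rfl)
  rw [nextMean_of_green, cost, hx]
  simp_rw [costG, mul_add]
  rw [((M.Pg_sum _).summable.mul_right _).tsum_add hp, tsum_mul_right, (M.Pg_sum _).tsum_eq,
    one_mul]

lemma estimates_succ_c (x : ℕ → W × E × H) (γ : ℕ → G) (t : ℕ) :
    (M.estimates ρ α X₀ x γ (t + 1)).c = M.updC (M.estimates ρ α X₀ x γ t) (ρ t) (x t) (γ t) := rfl

lemma estimates_succ_V (x : ℕ → W × E × H) (γ : ℕ → G) (t : ℕ) :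
    (M.estimates ρ α X₀ x γ (t + 1)).V =
      M.updV (M.estimates ρ α X₀ x γ t) (ρ t) (α t) (x t) (x (t + 1)) (γ t) := rfl

lemma estimates_succ_C (x : ℕ → W × E × H) (γ : ℕ → G) (t : ℕ) :
    (M.estimates ρ α X₀ x γ (t + 1)).C = M.updN (M.estimates ρ α X₀ x γ t) (ρ t) (x t) (γ t) := rfl

/-- The estimates of slot `t` are determined by exogenous states up to `t` and green powers before
`t`. They are thus predictable, whatever the battery levels and actions. -/
lemma estimates_congr {x x' : ℕ → W × E × H} {γ γ' : ℕ → G} {t : ℕ}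
    (hx : ∀ k ≤ t, x k = x' k) (hγ : ∀ k < t, γ k = γ' k) :
    M.estimates ρ α X₀ x γ t = M.estimates ρ α X₀ x' γ' t := by
  induction t with
  | zero => rfl
  | succ t ih =>
    simp only [estimates]
    rw [ih (fun k hk => hx k (hk.trans t.le_succ)) fun k hk => hγ k (hk.trans t.lt_succ_self),
      hx t t.le_succ, hx (t + 1) le_rfl, hγ t t.lt_succ_self]

/-- The cost estimates are bounded by `(1 - δ) K` and the value estimates by `K`. -/
structure Estimates.BoundedBy (X : M.Estimates) (K : ℝ) : Prop where
  c : ∀ s a, |X.c s a| ≤ (1 - M.disc) * K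
  V : ∀ p, |X.V p| ≤ K
  C : ∀ s, |X.C s| ≤ K

lemma Estimates.BoundedBy.mono {X : M.Estimates} {K K' : ℝ} (h : X.BoundedBy K) (hK : K ≤ K') :
    X.BoundedBy K' :=
  ⟨fun s a => (h.c s a).trans
    (mul_le_mul_of_nonneg_left hK (sub_nonneg.2 M.disc_lt_one.le)),
    fun p => (h.V p).trans hK, fun s => (h.C s).trans hK⟩

lemma Estimates.exists_boundedBy (X : M.Estimates) (K₀ : ℝ) : ∃ K, K₀ ≤ K ∧ X.BoundedBy K := by
  obtain ⟨a, ha⟩ := (Set.finite_range fun q : Σ s, M.Act s => |X.c q.1 q.2|).bddAbove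
  obtain ⟨b, hb⟩ := (Set.finite_range fun p => |X.V p|).bddAbove
  obtain ⟨c, hc⟩ := (Set.finite_range fun s => |X.C s|).bddAbove
  have hδ : 0 < 1 - M.disc := sub_pos.2 M.disc_lt_one
  refine ⟨max K₀ (max (a / (1 - M.disc)) (max b c)), le_max_left _ _, fun s x => ?_, fun p => ?_,
    fun s => ?_⟩
  · have h1 : |X.c s x| ≤ a := ha ⟨⟨s, x⟩, rfl⟩
    have h2 : a / (1 - M.disc) ≤ max K₀ (max (a / (1 - M.disc)) (max b c)) := by simp
    rw [div_le_iff₀' hδ] at h2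
    exact h1.trans h2
  · have h1 : |X.V p| ≤ b := hb ⟨p, rfl⟩
    exact h1.trans (by simp)
  · have h1 : |X.C s| ≤ c := hc ⟨s, rfl⟩
    exact h1.trans (by simp)

lemma abs_convex_comb_le {r y z a b : ℝ} (hr0 : 0 ≤ r) (hy : |y| ≤ a) (hz : |z| ≤ b) :
    |(1 - r) * y + r * z| ≤ |1 - r| * a + r * b := by
  refine (abs_add_le _ _).trans ?_
  rw [abs_mul, abs_mul, abs_of_nonneg hr0]
  exact add_le_add (mul_le_mul_of_nonneg_left hy (abs_nonneg _)) (mul_le_mul_of_nonneg_left hz hr0)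

/-- The update step with multiplicative slack `σ` for the cost estimates and `τ` for the
post-decision value estimates. -/
lemma Estimates.BoundedBy.update {X : M.Estimates} {K Kg r q σ τ : ℝ} (h : X.BoundedBy K)
    (hKg : ∀ s (a : M.Act s) γ, |M.costG s a γ| ≤ Kg) (hK : Kg ≤ (1 - M.disc) * K)
    (hr : 0 ≤ r) (hq : 0 ≤ q) (hσ : 1 ≤ σ) (hτ : 1 ≤ τ) (hrσ : |1 - r| + r ≤ σ)
    (hqτ : |1 - q| + q ≤ τ) (x x' : W × E × H) (γ : G) :
    Estimates.BoundedBy (M := M)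
      ⟨M.updC X r x γ, M.updV X r q x x' γ, M.updN X r x γ⟩ (τ * σ * K) := by
  have hδ0 := M.disc_nonneg
  have hδ : 0 < 1 - M.disc := sub_pos.2 M.disc_lt_one
  have hσ0 : 0 ≤ σ := zero_le_one.trans hσ
  have hc : ∀ s a, |M.updC X r x γ s a| ≤ (1 - M.disc) * (σ * K) := by
    intro s a
    have hK0 : 0 ≤ (1 - M.disc) * K := (abs_nonneg _).trans (h.c s a)
    unfold updC
    split_ifs
    · refine (abs_convex_comb_le hr (h.c s a) ((hKg s a γ).trans hK)).trans ?_
      rw [← add_mul]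
      nlinarith [mul_le_mul_of_nonneg_right hrσ hK0]
    · refine (h.c s a).trans ?_
      nlinarith [mul_le_mul_of_nonneg_right hσ hK0]
  have hN : ∀ s, |M.updN X r x γ s| ≤ σ * K := by
    intro s
    have hK0 : 0 ≤ K := (abs_nonneg _).trans (h.C s)
    unfold updN
    split_ifs
    · refine abs_iInf_le_of_finite fun a => ?_
      refine (abs_add_le _ _).trans ?_
      rw [abs_mul, abs_of_nonneg hδ0]
      -- The normalization `(1 - δ) K` of the cost bound is what closes the induction: `(1 - δ) σ K
      -- + δ K ≤ σ K`.
      have h1 := mul_le_mul_of_nonneg_left (h.V (M.post s a)) hδ0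
      have h2 := mul_le_mul_of_nonneg_left (mul_le_mul_of_nonneg_right hσ hK0) hδ0
      linarith [hc s a]
    · exact (h.C s).trans (le_mul_of_one_le_left hK0 hσ)
  have hV : ∀ p, |M.updV X r q x x' γ p| ≤ τ * σ * K := by
    intro p
    have hK0 : 0 ≤ K := (abs_nonneg _).trans (h.V p)
    have hK1 : K ≤ σ * K := le_mul_of_one_le_left hK0 hσ
    unfold updV
    split_ifs
    · refine (abs_convex_comb_le hq ((h.V p).trans hK1) (hN _)).trans ?_
      rw [← add_mul, mul_assoc]
      exact mul_le_mul_of_nonneg_right hqτ (hK0.trans hK1)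
    · rw [mul_assoc]
      exact (h.V p).trans (hK1.trans (le_mul_of_one_le_left (hK0.trans hK1) hτ))
  refine ⟨fun s a => ?_, hV, fun s => ?_⟩
  · have h0 : 0 ≤ (1 - M.disc) * (σ * K) := (abs_nonneg _).trans (hc s a)
    refine (hc s a).trans ?_
    calc (1 - M.disc) * (σ * K) ≤ τ * ((1 - M.disc) * (σ * K)) := le_mul_of_one_le_left h0 hτ
      _ = (1 - M.disc) * (τ * σ * K) := by ring
  · have h0 : 0 ≤ σ * K := (abs_nonneg _).trans (hN s)
    rw [mul_assoc]
    exact (hN s).trans (le_mul_of_one_le_left h0 hτ)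

/-- The estimates are bounded uniformly in time and in the realized trajectory. -/
lemma exists_estimates_boundedBy (hρ : ∀ t, 0 ≤ ρ t) (hα : ∀ t, 0 ≤ α t)
    (hρ0 : Tendsto ρ atTop (𝓝 0)) (hα0 : Tendsto α atTop (𝓝 0)) :
    ∃ K, ∀ x γ t, (M.estimates ρ α X₀ x γ t).BoundedBy K := by
  obtain ⟨Kg, hKg0, hKg⟩ := exists_costG_bound (M := M)
  have hδ : 0 < 1 - M.disc := sub_pos.2 M.disc_lt_one
  have hKK : ∀ K, Kg / (1 - M.disc) ≤ K → Kg ≤ (1 - M.disc) * K := fun K hK => by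
    rwa [div_le_iff₀' hδ] at hK
  -- Early learning rates may exceed one; each such slot inflates the bound by a deterministic
  -- factor. Once both rates stay below one, the updates are convex combinations and the bound no
  -- longer grows.
  have hfin : ∀ t, ∃ K, Kg / (1 - M.disc) ≤ K ∧
      ∀ x γ, ∀ k ≤ t, (M.estimates ρ α X₀ x γ k).BoundedBy K := by
    intro t
    induction t with
    | zero =>
      obtain ⟨K, hK, hX⟩ := X₀.exists_boundedBy (Kg / (1 - M.disc))
      refine ⟨K, hK, fun x γ k hk => ?_⟩
      obtain rfl : k = 0 := Nat.le_zero.1 hk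
      exact hX
    | succ t ih =>
      obtain ⟨K, hK, hX⟩ := ih
      have hK0 : 0 ≤ K := (div_nonneg hKg0 hδ.le).trans hK
      have hslack : ∀ r : ℝ, 0 ≤ r → |1 - r| + r ≤ 1 + 2 * r := fun r hr => by
        have := abs_sub (1 : ℝ) r
        rw [abs_one, abs_of_nonneg hr] at this
        linarith
      have h1 : 1 ≤ 1 + 2 * ρ t := by linarith [hρ t]
      have h2 : 1 ≤ 1 + 2 * α t := by linarith [hα t]
      have hle : K ≤ (1 + 2 * α t) * (1 + 2 * ρ t) * K :=
        le_mul_of_one_le_left hK0 (one_le_mul_of_one_le_of_one_le h2 h1)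
      refine ⟨_, hK.trans hle, fun x γ k hk => ?_⟩
      rcases Nat.le_succ_iff.1 hk with hk | rfl
      · exact (hX x γ k hk).mono hle
      · exact (hX x γ t le_rfl).update hKg (hKK K hK) (hρ t) (hα t) h1 h2 (hslack _ (hρ t))
          (hslack _ (hα t)) _ _ _
  obtain ⟨T, hT⟩ := eventually_atTop.1
    ((hρ0.eventually (eventually_le_nhds one_pos)).and (hα0.eventually (eventually_le_nhds one_pos)))
  obtain ⟨K, hK, hX⟩ := hfin T
  refine ⟨K, fun x γ t => ?_⟩
  rcases le_total t T with h | h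
  · exact hX x γ t h
  · induction t, h using Nat.le_induction with
    | base => exact hX x γ T le_rfl
    | succ t ht ih =>
      have hone : ∀ r : ℝ, r ≤ 1 → |1 - r| + r ≤ 1 := fun r hr => by
        rw [abs_of_nonneg (sub_nonneg.2 hr)]
        linarith
      have := ih.update hKg (hKK K hK) (hρ t) (hα t) le_rfl le_rfl (hone _ (hT t ht).1)
        (hone _ (hT t ht).2) (x t) (x (t + 1)) (γ t)
      rwa [one_mul, one_mul] at this

/-- The normal value estimates after the update of a slot with exogenous state `x`, computed with
the cost estimates before the update. -/
def prelimC (X : M.Estimates) (x : W × E × H) (s : M.State) : ℝ :=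
  if s.1.2.1 = x.2.1 then ⨅ a : M.Act s, (X.c s a + M.disc * X.V (M.post s a)) else X.C s

lemma abs_prelimC_le {X : M.Estimates} {K : ℝ} (h : X.BoundedBy K) (x : W × E × H) (s : M.State) :
    |prelimC X x s| ≤ K := by
  unfold prelimC
  split_ifs
  · refine abs_iInf_le_of_finite fun a => (abs_add_le _ _).trans ?_
    rw [abs_mul, abs_of_nonneg M.disc_nonneg]
    linarith [h.c s a, mul_le_mul_of_nonneg_left (h.V (M.post s a)) M.disc_nonneg]
  · exact h.C s

/-- `updN` already contains the green power of the current slot and is not predictable, whereas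
`prelimC` is. Exchanging them costs `O(ρ)`, which vanishes and is absorbed into the drift target. -/
lemma abs_updN_sub_prelimC_le {X : M.Estimates} {r D : ℝ} (hr : 0 ≤ r) {γ : G}
    (hD : ∀ s a, |M.costG s a γ - X.c s a| ≤ D) (hD0 : 0 ≤ D) (x : W × E × H) (s : M.State) :
    |M.updN X r x γ s - prelimC X x s| ≤ r * D := by
  unfold updN prelimC
  split_ifs with h
  · refine abs_iInf_sub_iInf_le fun a => ?_
    have : M.updC X r x γ s a + M.disc * X.V (M.post s a) -
        (X.c s a + M.disc * X.V (M.post s a)) = r * (M.costG s a γ - X.c s a) := by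
      rw [updC, if_pos h]
      ring
    rw [this, abs_mul, abs_of_nonneg hr]
    exact mul_le_mul_of_nonneg_left (hD s a) hr
  · rw [sub_self, abs_zero]
    exact mul_nonneg hr hD0

namespace IsRun

variable {Ω : Type*} [mΩ : MeasurableSpace Ω] {P : Measure Ω} {ℱ : Filtration ℕ mΩ}
  {S : ℕ → Ω → M.State} {A : (t : ℕ) → (ω : Ω) → M.Act (S t ω)} {Γ : ℕ → Ω → G}

lemma stronglyMeasurable_of_history [Countable G] (hrun : M.IsRun P ℱ ρ α X₀ S A Γ) (t : ℕ)
    {F : Ω → ℝ} (hF : ∀ ω ω', (∀ k ≤ t, (S k ω).1 = (S k ω').1) →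
      (∀ k < t, Γ k ω = Γ k ω') → F ω = F ω') : StronglyMeasurable[ℱ t] F := by
  refine stronglyMeasurable_of_countable_factor
    (u := fun ω => ((fun k : Fin (t + 1) => (S k ω).1), fun k : Fin t => Γ k ω))
    (fun q => ?_) fun ω ω' h => ?_
  · have : {ω | ((fun k : Fin (t + 1) => (S k ω).1), fun k : Fin t => Γ k ω) = q} =
        (⋂ k : Fin (t + 1), {ω | (S k ω).1 = q.1 k}) ∩ ⋂ k : Fin t, {ω | Γ k ω = q.2 k} := by
      ext ω
      simp only [Set.mem_ofPred_eq, Prod.ext_iff, funext_iff, Set.mem_inter_iff, Set.mem_iInter]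
    rw [this]
    refine (MeasurableSet.iInter fun k => ?_).inter (MeasurableSet.iInter fun k => ?_)
    · exact ℱ.mono (Nat.lt_succ_iff.1 k.2) _ (hrun.measurableSet_exo k _)
    · exact ℱ.mono (Nat.succ_le_of_lt k.2) _ (hrun.green_meas k _)
  · rw [Prod.mk.injEq] at h
    exact hF ω ω' (fun k hk => congrFun h.1 ⟨k, Nat.lt_succ_of_le hk⟩)
      fun k hk => congrFun h.2 ⟨k, hk⟩

end IsRun

end EdgeSystem

end

/-! ### Pathwise convergence of the value estimates -/

noncomputable section

/-- The infimum of the valid bounds, though possibly not attained, cannot be positive: a bound close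
to it would be improved to one strictly below it. -/
lemma exists_small_of_contracting_bounds {δ : ℝ} (hδ0 : 0 ≤ δ) (hδ1 : δ < 1) {Q : ℝ → Prop}
    (hQ : ∃ u, 0 ≤ u ∧ Q u) (hstep : ∀ u, 0 ≤ u → Q u → ∀ ε > 0, Q (δ * u + ε)) {ε : ℝ}
    (hε : 0 < ε) : ∃ u < ε, 0 ≤ u ∧ Q u := by
  have hbdd : BddBelow {u | 0 ≤ u ∧ Q u} := ⟨0, fun u hu => hu.1⟩
  set u₀ := sInf {u | 0 ≤ u ∧ Q u} with hu₀
  have h0 : 0 ≤ u₀ := Real.sInf_nonneg fun u hu => hu.1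
  have hzero : u₀ ≤ 0 := by
    by_contra hpos
    push Not at hpos
    -- With this choice `δ * (u₀ + η) + η ≤ δ * u₀ + (1 - δ) * u₀ / 2 < u₀`.
    set η := (1 - δ) * u₀ / 4 with hη
    have hη0 : 0 < η := by have := sub_pos.2 hδ1; positivity
    obtain ⟨u, ⟨hu, hQu⟩, hlt⟩ := exists_lt_of_csInf_lt hQ (lt_add_of_pos_right u₀ hη0)
    have h1 : u₀ ≤ δ * u + η :=
      csInf_le hbdd ⟨by positivity, hstep u hu hQu η hη0⟩
    have h2 := mul_le_mul_of_nonneg_left hlt.le hδ0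
    have h3 : δ * η ≤ η := mul_le_of_le_one_left hη0.le hδ1.le
    nlinarith
  obtain ⟨u, hu, hlt⟩ := exists_lt_of_csInf_lt hQ (hzero.trans_lt hε)
  exact ⟨u, hlt, hu⟩

namespace EdgeSystem

variable {L W E H G : Type*} [Fintype L] [Fintype W] [Fintype E] [Fintype H]
  [DecidableEq W] [DecidableEq E] [DecidableEq H] {M : EdgeSystem L W E H G}
  {ρ α : ℕ → ℝ} {X₀ : M.Estimates}

section Trajectory

variable {x : ℕ → W × E × H} {γ : ℕ → G}

/-- If every environment state recurs, the normal value estimates inherit, up to the discount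
factor, the accuracy of the post-decision value estimates. -/
lemma eventually_abs_C_sub_le
    (hvisit : ∀ e, ∃ᶠ t in atTop, (x t).2.1 = e)
    (hc : ∀ s a, Tendsto (fun t => (M.estimates ρ α X₀ x γ t).c s a) atTop (𝓝 (M.cost s a)))
    {u ε : ℝ}
    (hV : ∀ᶠ t in atTop, ∀ p, |(M.estimates ρ α X₀ x γ t).V p - M.optPValue p| ≤ u)
    (hε : 0 < ε) :
    ∀ᶠ t in atTop, ∀ s, |(M.estimates ρ α X₀ x γ t).C s - M.optValue s| ≤ M.disc * u + ε ∧
      |prelimC (M.estimates ρ α X₀ x γ t) (x t) s - M.optValue s| ≤ M.disc * u + ε := by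
  set X := M.estimates ρ α X₀ x γ with hX
  have hcε : ∀ᶠ t in atTop, ∀ s a, |(X t).c s a - M.cost s a| ≤ ε := by
    simp only [eventually_all]
    intro s a
    filter_upwards [(hc s a).eventually (Metric.closedBall_mem_nhds _ hε)] with t ht
    exact ht
  obtain ⟨T, hT⟩ := eventually_atTop.1 (hV.and hcε)
  have hmin : ∀ (f : (s : M.State) → M.Act s → ℝ) (v : M.PState → ℝ) s,
      (∀ a, |f s a - M.cost s a| ≤ ε) → (∀ p, |v p - M.optPValue p| ≤ u) →
      |(⨅ a : M.Act s, (f s a + M.disc * v (M.post s a))) - M.optValue s| ≤ M.disc * u + ε := by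
    intro f v s hf hv
    rw [optValue_eq_iInf]
    refine abs_iInf_sub_iInf_le fun a => ?_
    have h1 : f s a + M.disc * v (M.post s a) - (M.cost s a + M.disc * M.optPValue (M.post s a)) =
        M.disc * (v (M.post s a) - M.optPValue (M.post s a)) + (f s a - M.cost s a) := by ring
    rw [h1]
    refine (abs_add_le _ _).trans (add_le_add ?_ (hf a))
    rw [abs_mul, abs_of_nonneg M.disc_nonneg]
    exact mul_le_mul_of_nonneg_left (hv _) M.disc_nonneg
  have hC : ∀ᶠ t in atTop, ∀ s, |(X t).C s - M.optValue s| ≤ M.disc * u + ε := by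
    rw [eventually_all]
    intro s
    -- A normal value is refreshed only when its environment occurs. After the first such slot past
    -- `T` the bound holds, and it survives the slots in which the estimate is frozen.
    obtain ⟨τ, hτT, hτ⟩ := frequently_atTop.1 (hvisit s.1.2.1) T
    have hupd : ∀ t ≥ T, s.1.2.1 = (x t).2.1 →
        |(X (t + 1)).C s - M.optValue s| ≤ M.disc * u + ε := by
      intro t ht he
      rw [hX, estimates_succ_C, updN, if_pos he, ← estimates_succ_c]
      exact hmin _ _ s ((hT (t + 1) (ht.trans t.le_succ)).2 s) (hT t ht).1
    refine eventually_atTop.2 ⟨τ + 1, fun t ht => ?_⟩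
    induction t, ht using Nat.le_induction with
    | base => exact hupd τ hτT hτ.symm
    | succ t ht ih =>
      by_cases he : s.1.2.1 = (x t).2.1
      · exact hupd t (hτT.trans (τ.le_succ.trans ht)) he
      · rw [hX, estimates_succ_C, updN, if_neg he]
        exact ih
  filter_upwards [hC, eventually_ge_atTop T] with t h1 h2 s
  refine ⟨h1 s, ?_⟩
  unfold prelimC
  split_ifs
  · exact hmin _ _ s ((hT t h2).2 s) (hT t h2).1
  · exact h1 s

/-- The deviation of the observed continuation value from its conditional expectation, weighted
by the learning rate. -/
def valueNoise (X : ℕ → M.Estimates) (α : ℕ → ℝ) (x : ℕ → W × E × H) (γ : ℕ → G) (p : M.PState)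
    (s : M.State) (t : ℕ) : ℝ :=
  ((if x t = p.1 then α t else 0) * prelimC (X t) (x t) s) *
    ((open Classical in if (x (t + 1), M.nextBat p.2 (γ t)) = s then 1 else 0) - M.ptrans p s)

/-- Pathwise convergence of the value estimates when the noise series converge. -/
lemma tendsto_values_of_noise (hρ : ∀ t, 0 ≤ ρ t) (hα : ∀ t, 0 ≤ α t)
    (hρ0 : Tendsto ρ atTop (𝓝 0)) (hα0 : Tendsto α atTop (𝓝 0))
    {K : ℝ} (hK : ∀ t, (M.estimates ρ α X₀ x γ t).BoundedBy K)
    (hvisit : ∀ e, ∃ᶠ t in atTop, (x t).2.1 = e)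
    (hαx : ∀ y, Tendsto (fun n => ∑ t ∈ Finset.range n, if x t = y then α t else 0) atTop atTop)
    (hc : ∀ s a, Tendsto (fun t => (M.estimates ρ α X₀ x γ t).c s a) atTop (𝓝 (M.cost s a)))
    (hnoise : ∀ p s, ∃ l, Tendsto (fun n => ∑ t ∈ Finset.range n,
      valueNoise (M.estimates ρ α X₀ x γ) α x γ p s t) atTop (𝓝 l)) :
    (∀ p, Tendsto (fun t => (M.estimates ρ α X₀ x γ t).V p) atTop (𝓝 (M.optPValue p))) ∧
      ∀ s, Tendsto (fun t => (M.estimates ρ α X₀ x γ t).C s) atTop (𝓝 (M.optValue s)) := by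
  classical
  set X := M.estimates ρ α X₀ x γ with hX
  obtain ⟨Kg, hKg0, hKg⟩ := exists_costG_bound (M := M)
  set D := Kg + |(1 - M.disc) * K| with hD
  have hD0 : 0 ≤ D := add_nonneg hKg0 (abs_nonneg _)
  have hXD : ∀ t s a, |M.costG s a (γ t) - (X t).c s a| ≤ D := fun t s a =>
    (abs_sub _ _).trans (add_le_add (hKg s a _) (((hK t).c s a).trans (le_abs_self _)))
  have hstep : ∀ u, 0 ≤ u → (∀ᶠ t in atTop, ∀ p, |(X t).V p - M.optPValue p| ≤ u) → ∀ ε > 0,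
      ∀ᶠ t in atTop, ∀ p, |(X t).V p - M.optPValue p| ≤ M.disc * u + ε := by
    intro u _ hu ε hε
    rw [eventually_all]
    intro p
    choose l hl using hnoise p
    set β : ℕ → ℝ := fun t => if x t = p.1 then α t else 0 with hβ
    -- The drift target is the kernel average of the normal value error, of size `δ u` up to a small
    -- term, plus the vanishing error of replacing `updN` by `prelimC`.
    set r : ℕ → ℝ := fun t => ∑ s, M.ptrans p s * (prelimC (X t) (x t) s - M.optValue s) +
      (M.updN (X t) (ρ t) (x t) (γ t) (x (t + 1), M.nextBat p.2 (γ t)) -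
        prelimC (X t) (x t) (x (t + 1), M.nextBat p.2 (γ t))) with hr
    have hβ0 : ∀ t, 0 ≤ β t := fun t => by
      simp only [hβ]
      split_ifs
      exacts [hα t, le_rfl]
    have hβlim : Tendsto β atTop (𝓝 0) := by
      refine squeeze_zero hβ0 (fun t => ?_) hα0
      simp only [hβ]
      split_ifs
      exacts [le_rfl, hα t]
    have hz : Tendsto (fun n => ∑ t ∈ Finset.range n, ∑ s, valueNoise X α x γ p s t) atTop
        (𝓝 (∑ s, l s)) := by
      simp_rw [Finset.sum_comm (s := Finset.range _)]
      exact tendsto_finsetSum _ fun s _ => hl s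
    have hrec : ∀ t, (X (t + 1)).V p - M.optPValue p =
        (1 - β t) * ((X t).V p - M.optPValue p) + β t * r t +
          ∑ s, valueNoise X α x γ p s t := by
      intro t
      have h1 : ∑ s, valueNoise X α x γ p s t = β t *
          (prelimC (X t) (x t) (x (t + 1), M.nextBat p.2 (γ t)) -
            ∑ s, M.ptrans p s * prelimC (X t) (x t) s) := by
        have h2 : prelimC (X t) (x t) (x (t + 1), M.nextBat p.2 (γ t)) =
            ∑ s, prelimC (X t) (x t) s *
              (if (x (t + 1), M.nextBat p.2 (γ t)) = s then 1 else 0) := by simp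
        rw [h2, ← Finset.sum_sub_distrib, Finset.mul_sum]
        refine Finset.sum_congr rfl fun s _ => ?_
        simp only [valueNoise, hβ]
        ring
      have h3 : r t = ∑ s, M.ptrans p s * prelimC (X t) (x t) s - M.optPValue p +
          (M.updN (X t) (ρ t) (x t) (γ t) (x (t + 1), M.nextBat p.2 (γ t)) -
        prelimC (X t) (x t) (x (t + 1), M.nextBat p.2 (γ t))) := by
        simp only [hr, mul_sub, Finset.sum_sub_distrib, optPValue]
      rw [h1, h3, hX, estimates_succ_V, ← hX, updV]
      simp only [hβ, eq_comm (a := p.1)]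
      split_ifs <;> ring
    have hrb : ∀ᶠ t in atTop, |r t| ≤ M.disc * u + ε / 3 + ε / 3 := by
      have h1 : ∀ᶠ t in atTop, ρ t * D ≤ ε / 3 := by
        have : Tendsto (fun t => ρ t * D) atTop (𝓝 0) := by simpa using hρ0.mul_const D
        exact this.eventually (eventually_le_nhds (by positivity))
      filter_upwards [h1, eventually_abs_C_sub_le hvisit hc hu (ε := ε / 3) (by positivity)]
        with t h2 h3
      refine (abs_add_le _ _).trans (add_le_add ?_ ?_)
      · exact abs_ptrans_sum_le p fun s => (h3 s).2
      · exact (abs_updN_sub_prelimC_le (hρ t) (hXD t) hD0 _ _).trans h2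
    filter_upwards [eventually_abs_le_of_robbinsMonro
      (Y := fun t => (X t).V p - M.optPValue p) (ε := ε / 3) hβ0 hβlim (hαx p.1) hz hrec hrb
      (by positivity)] with t ht
    linarith
  have hsmall : ∀ ε > 0, ∃ u < ε, 0 ≤ u ∧
      ∀ᶠ t in atTop, ∀ p, |(X t).V p - M.optPValue p| ≤ u := by
    intro ε hε
    refine exists_small_of_contracting_bounds M.disc_nonneg M.disc_lt_one ?_ hstep hε
    obtain ⟨B, hB⟩ := (Set.finite_range fun p => |M.optPValue p|).bddAbove
    refine ⟨|K| + |B|, by positivity, Eventually.of_forall fun t p => (abs_sub _ _).trans ?_⟩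
    exact add_le_add (((hK t).V p).trans (le_abs_self _))
      ((hB ⟨p, rfl⟩).trans (le_abs_self _))
  constructor
  · intro p
    rw [Metric.tendsto_atTop']
    intro ε hε
    obtain ⟨u, huε, -, hu⟩ := hsmall ε hε
    obtain ⟨T, hT⟩ := eventually_atTop.1 hu
    exact ⟨T, fun t ht => (hT t (le_of_lt ht) p).trans_lt huε⟩
  · intro s
    rw [Metric.tendsto_atTop']
    intro ε hε
    obtain ⟨u, huε, hu0, hu⟩ := hsmall (ε / 2) (by positivity)
    obtain ⟨T, hT⟩ := eventually_atTop.1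
      (eventually_abs_C_sub_le hvisit hc hu (ε := ε / 3) (by positivity))
    refine ⟨T, fun t ht => ((hT t (le_of_lt ht) s).1).trans_lt ?_⟩
    have := mul_le_of_le_one_left hu0 M.disc_lt_one.le
    linarith

end Trajectory

lemma frequently_of_tendsto_sum_ite {κ : Type*} [DecidableEq κ] {z : ℕ → κ} {k : κ} {a : ℕ → ℝ}
    (h : Tendsto (fun n => ∑ t ∈ Finset.range n, if z t = k then a t else 0) atTop atTop) :
    ∃ᶠ t in atTop, z t = k := by
  intro hev
  obtain ⟨T, hT⟩ := eventually_atTop.1 hev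
  have hconst : ∀ n ≥ T, (∑ t ∈ Finset.range n, if z t = k then a t else 0) =
      ∑ t ∈ Finset.range T, if z t = k then a t else 0 := by
    intro n hn
    symm
    refine Finset.sum_subset (Finset.range_subset_range.2 hn) fun t _ ht => ?_
    exact if_neg (hT t (by simpa using ht))
  obtain ⟨n, hn, hnT⟩ := ((h.eventually_gt_atTop
    (∑ t ∈ Finset.range T, if z t = k then a t else 0)).and (eventually_ge_atTop T)).exists
  exact absurd (hconst n hnT) hn.ne'

/-! ### Almost sure convergence along sufficient visits -/

namespace IsRun

variable {Ω : Type*} [mΩ : MeasurableSpace Ω] {P : Measure Ω} {ℱ : Filtration ℕ mΩ}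
  {S : ℕ → Ω → M.State} {A : (t : ℕ) → (ω : Ω) → M.Act (S t ω)} {Γ : ℕ → Ω → G}
  [Countable G] [IsProbabilityMeasure P]

/-- The cost estimates receive no feedback from the values: their errors follow a recursion with
target zero and pure martingale noise. -/
lemma ae_tendsto_cost (hrun : M.IsRun P ℱ ρ α X₀ S A Γ) (hρ : ∀ t, 0 ≤ ρ t)
    (hρ2 : Summable fun t => ρ t ^ 2) (hρ0 : Tendsto ρ atTop (𝓝 0)) :
    ∀ᵐ ω ∂P, (∀ e : E, Tendsto (fun n => ∑ t ∈ Finset.range n,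
        if (S t ω).1.2.1 = e then ρ t else 0) atTop atTop) →
      ∀ s a, Tendsto (fun t => (M.estimates ρ α X₀ (fun k => (S k ω).1) (fun k => Γ k ω) t).c s a)
        atTop (𝓝 (M.cost s a)) := by
  obtain ⟨K, hK0, hK⟩ := exists_costG_bound (M := M)
  have hnoise : ∀ᵐ ω ∂P, ∀ s (a : M.Act s), ∃ l, Tendsto (fun n => ∑ t ∈ Finset.range n,
      (if (S t ω).1.2.1 = s.1.2.1 then ρ t else 0) * (M.costG s a (Γ t ω) -
        M.nextMean (S t ω).1 fun γ _ => M.costG s a γ)) atTop (𝓝 l) := by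
    refine ae_all_iff.2 fun s => ae_all_iff.2 fun a => ?_
    refine hrun.ae_exists_tendsto_sum_deviation (f := fun γ _ => M.costG s a γ) (a := ρ)
      (fun γ _ => hK s a γ)
      (fun t => hrun.stronglyMeasurable_exo t fun y => if y.2.1 = s.1.2.1 then ρ t else 0)
      (fun t ω => ?_) hρ2
    split_ifs
    · rw [abs_of_nonneg (hρ t)]
    · simpa using hρ t
  filter_upwards [hnoise] with ω hω hvis s a
  obtain ⟨l, hl⟩ := hω s a
  set x : ℕ → W × E × H := fun k => (S k ω).1 with hx
  set γ : ℕ → G := fun k => Γ k ω with hγ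
  set β : ℕ → ℝ := fun t => if (x t).2.1 = s.1.2.1 then ρ t else 0 with hβ
  have hβ0 : ∀ t, 0 ≤ β t := fun t => by
    simp only [hβ]
    split_ifs
    exacts [hρ t, le_rfl]
  have hβlim : Tendsto β atTop (𝓝 0) := by
    refine squeeze_zero hβ0 (fun t => ?_) hρ0
    simp only [hβ]
    split_ifs
    exacts [le_rfl, hρ t]
  have hrec : ∀ t, (M.estimates ρ α X₀ x γ (t + 1)).c s a - M.cost s a =
      (1 - β t) * ((M.estimates ρ α X₀ x γ t).c s a - M.cost s a) + β t * 0 +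
        β t * (M.costG s a (γ t) - M.nextMean (x t) fun γ _ => M.costG s a γ) := by
    intro t
    rw [estimates_succ_c, updC]
    simp only [hβ, eq_comm (a := s.1.2.1)]
    split_ifs with h
    · rw [nextMean_costG a h.symm]
      ring
    · ring
  rw [Metric.tendsto_atTop']
  intro ε hε
  obtain ⟨T, hT⟩ := eventually_atTop.1 (eventually_abs_le_of_robbinsMonro (u := 0)
    (Y := fun t => (M.estimates ρ α X₀ x γ t).c s a - M.cost s a) (r := fun _ => 0)
    (ε := ε / 2) hβ0 hβlim (hvis s.1.2.1) hl hrec (by simp) (by positivity))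
  refine ⟨T, fun t ht => (hT t (le_of_lt ht)).trans_lt ?_⟩
  linarith

/-- Splitting the noise by target state `s` leaves a fixed indicator as observable and moves the
history-dependent value estimate into the predictable weight, bounded by `α t * K`. -/
lemma ae_exists_tendsto_sum_valueNoise (hrun : M.IsRun P ℱ ρ α X₀ S A Γ)
    (hα : ∀ t, 0 ≤ α t) (hα2 : Summable fun t => α t ^ 2) {K : ℝ}
    (hK : ∀ x γ t, (M.estimates ρ α X₀ x γ t).BoundedBy K) :
    ∀ᵐ ω ∂P, ∀ p s, ∃ l, Tendsto (fun n => ∑ t ∈ Finset.range n,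
      valueNoise (M.estimates ρ α X₀ (fun k => (S k ω).1) (fun k => Γ k ω)) α
        (fun k => (S k ω).1) (fun k => Γ k ω) p s t) atTop (𝓝 l) := by
  classical
  refine ae_all_iff.2 fun p => ae_all_iff.2 fun s => ?_
  have hdev := hrun.ae_exists_tendsto_sum_deviation
    (f := fun γ x' => if (x', M.nextBat p.2 γ) = s then 1 else 0) (K := 1)
    (h := fun t ω => (if (S t ω).1 = p.1 then α t else 0) *
      prelimC (M.estimates ρ α X₀ (fun k => (S k ω).1) (fun k => Γ k ω) t) (S t ω).1 s)
    (a := fun t => α t * K) (fun γ x => by split_ifs <;> simp) (fun t => ?_) (fun t ω => ?_)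
    (by simpa only [mul_pow] using hα2.mul_right _)
  · filter_upwards [hdev] with ω ⟨l, hl⟩
    refine ⟨l, hl.congr fun n => Finset.sum_congr rfl fun t _ => ?_⟩
    by_cases h : (S t ω).1 = p.1
    · simp only [valueNoise, ptrans_eq_nextMean, h]
    · simp only [valueNoise, if_neg h, zero_mul]
  · refine hrun.stronglyMeasurable_of_history t fun ω ω' h1 h2 => ?_
    rw [estimates_congr h1 h2, h1 t le_rfl]
  · rw [abs_mul]
    refine mul_le_mul ?_ (abs_prelimC_le (hK _ _ t) _ _) (abs_nonneg _) (hα t)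
    split_ifs
    · rw [abs_of_nonneg (hα t)]
    · simpa using hα t

/-- Almost sure convergence on the event that the learning rates are not summable along the
update slots. -/
lemma ae_converges_of_visits (hrun : M.IsRun P ℱ ρ α X₀ S A Γ) (hρ : ∀ t, 0 ≤ ρ t)
    (hα : ∀ t, 0 ≤ α t) (hρ2 : Summable fun t => ρ t ^ 2) (hα2 : Summable fun t => α t ^ 2) :
    ∀ᵐ ω ∂P,
      (∀ x : W × E × H, Tendsto (fun n => ∑ t ∈ Finset.range n,
        if (S t ω).1 = x then α t else 0) atTop atTop) →
      (∀ e : E, Tendsto (fun n => ∑ t ∈ Finset.range n,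
        if (S t ω).1.2.1 = e then ρ t else 0) atTop atTop) →
      M.Converges (M.estimates ρ α X₀ (fun t => (S t ω).1) (fun t => Γ t ω)) := by
  have hlim : ∀ a : ℕ → ℝ, (Summable fun t => a t ^ 2) → Tendsto a atTop (𝓝 0) := fun a ha => by
    have h := ha.tendsto_atTop_zero.sqrt
    simp only [Real.sqrt_sq_eq_abs, Real.sqrt_zero] at h
    exact (tendsto_zero_iff_abs_tendsto_zero a).2 h
  have hρ0 := hlim ρ hρ2
  have hα0 := hlim α hα2
  obtain ⟨K, hK⟩ := exists_estimates_boundedBy (X₀ := X₀) hρ hα hρ0 hα0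
  filter_upwards [hrun.ae_tendsto_cost hρ hρ2 hρ0,
    hrun.ae_exists_tendsto_sum_valueNoise hα hα2 hK] with ω h1 h2 hαx hρe
  have hc := h1 hρe
  obtain ⟨hV, hC⟩ := tendsto_values_of_noise hρ hα hρ0 hα0 (hK _ _)
    (fun e => frequently_of_tendsto_sum_ite (hρe e)) hαx hc h2
  exact ⟨hV, hC, hc, recoversPolicy_of_tendsto hV hc⟩

end IsRun

end EdgeSystem

end

/-! ### Divergence of the learning rates along visits -/

noncomputable section

namespace EdgeSystem

variable {L W E H G : Type*} [Fintype L] [Fintype W] [Fintype E] [Fintype H]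
  [DecidableEq W] [DecidableEq E] [DecidableEq H] {M : EdgeSystem L W E H G}
  {ρ α : ℕ → ℝ} {X₀ : M.Estimates}

namespace IsRun

variable {Ω : Type*} [mΩ : MeasurableSpace Ω] {P : Measure Ω} {ℱ : Filtration ℕ mΩ}
  {S : ℕ → Ω → M.State} {A : (t : ℕ) → (ω : Ω) → M.Act (S t ω)} {Γ : ℕ → Ω → G}
  [Countable G] [IsProbabilityMeasure P]

/-- The deviation over `k + 1` slots is the one-step deviation of `g` from slot `t + k`, plus the
`k`-step deviation of `M.Pexo.mulVec g` from slot `t`; hence the induction over all `g`. -/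
lemma ae_exists_tendsto_sum_pow_mulVec (hrun : M.IsRun P ℱ ρ α X₀ S A Γ) {a : ℕ → ℝ}
    (ha0 : ∀ t, 0 ≤ a t) (ha : Summable fun t => a t ^ 2) (k : ℕ) (g : W × E × H → ℝ) :
    ∀ᵐ ω ∂P, ∃ l, Tendsto (fun n => ∑ t ∈ Finset.range n,
      a t * (g (S (t + k) ω).1 - (M.Pexo ^ k).mulVec g (S t ω).1)) atTop (𝓝 l) := by
  induction k generalizing g with
  | zero => exact ae_of_all _ fun ω => ⟨0, by simp⟩
  | succ k ih =>
    obtain ⟨K, hK⟩ := (Set.finite_range fun x => |g x|).bddAbove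
    -- The one-step deviation happens at slot `s = t + k` but carries the weight of slot `t`; the
    -- shifted weight is zero before slot `k`.
    set a' : ℕ → ℝ := fun s => if k ≤ s then a (s - k) else 0 with ha'
    have hshift : ∀ t, a' (k + t) = a t := fun t => by simp [ha']
    have hsq : Summable fun s => a' s ^ 2 := by
      rw [← summable_nat_add_iff k]
      refine ha.congr fun t => ?_
      rw [add_comm, hshift]
    have ha'0 : ∀ s, 0 ≤ a' s := fun s => by
      simp only [ha']
      split_ifs
      exacts [ha0 _, le_rfl]
    have hstep := hrun.ae_exists_tendsto_sum_deviation (f := fun _ x' => g x') (K := K)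
      (h := fun s _ => a' s) (a := a') (fun _ x => hK ⟨x, rfl⟩)
      (fun _ => stronglyMeasurable_const) (fun s _ => (abs_of_nonneg (ha'0 s)).le) hsq
    filter_upwards [hstep, ih (M.Pexo.mulVec g)] with ω ⟨l₁, h₁⟩ ⟨l₂, h₂⟩
    refine ⟨l₁ + l₂, ((h₁.comp (tendsto_add_atTop_nat k)).add h₂).congr fun n => ?_⟩
    have hzero : ∀ s ∈ Finset.range k, a' s * (g (S (s + 1) ω).1 -
        M.nextMean (S s ω).1 fun _ x' => g x') = 0 := fun s hs => by
      simp [ha', not_le.2 (Finset.mem_range.1 hs)]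
    rw [Function.comp_apply, add_comm n k, Finset.sum_range_add, Finset.sum_eq_zero hzero,
      zero_add, ← Finset.sum_add_distrib]
    refine Finset.sum_congr rfl fun t _ => ?_
    rw [hshift, nextMean_of_exo, Matrix.mulVec_mulVec, ← pow_succ, add_comm k t, add_assoc]
    ring

/-- If in a window of `N` slots every state is hit with positive probability at a time of `T`, and
the rates at those times dominate the rate at the end of the window, then almost surely the rates
are not summable along the visits to `x`. -/
lemma ae_tendsto_sum_visits (hrun : M.IsRun P ℱ ρ α X₀ S A Γ) {a : ℕ → ℝ}
    (ha0 : ∀ t, 0 ≤ a t) (ha1 : Tendsto (fun n => ∑ t ∈ Finset.range n, a t) atTop atTop)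
    (ha2 : Summable fun t => a t ^ 2) {T : Finset ℕ} {N : ℕ} (hTN : ∀ k ∈ T, k ≤ N)
    (hT : ∀ k ∈ T, ∀ t, a (t + N) ≤ a (t + k))
    (hpos : ∀ x y, 0 < ∑ k ∈ T, (M.Pexo ^ k) x y) (y : W × E × H) :
    ∀ᵐ ω ∂P, Tendsto (fun n => ∑ t ∈ Finset.range n, if (S t ω).1 = y then a t else 0)
      atTop atTop := by
  have : Nonempty (W × E × H) := ⟨y⟩
  obtain ⟨x₀, hx₀⟩ := Finite.exists_min fun x => ∑ k ∈ T, (M.Pexo ^ k) x y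
  set c := ∑ k ∈ T, (M.Pexo ^ k) x₀ y with hc
  have hc0 : 0 < c := hpos x₀ y
  have hTne : T.Nonempty := by
    rw [Finset.nonempty_iff_ne_empty]
    rintro rfl
    simp [hc] at hc0
  set g : W × E × H → ℝ := Pi.single y 1 with hg
  have hPg : ∀ k x, (M.Pexo ^ k).mulVec g x = (M.Pexo ^ k) x y := fun k x => by
    rw [hg, Matrix.mulVec_single_one]
    rfl
  have hsq : Summable fun t => a (t + N) ^ 2 := (summable_nat_add_iff N).2 ha2
  have hall : ∀ᵐ ω ∂P, ∀ k : ℕ, ∃ l, Tendsto (fun n => ∑ t ∈ Finset.range n,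
      a (t + N) * (g (S (t + k) ω).1 - (M.Pexo ^ k).mulVec g (S t ω).1)) atTop (𝓝 l) :=
    ae_all_iff.2 fun k => hrun.ae_exists_tendsto_sum_pow_mulVec (fun t => ha0 _) hsq k g
  filter_upwards [hall] with ω hω
  choose l hl using hω
  set F : ℕ → ℝ := fun n => ∑ t ∈ Finset.range n, if (S t ω).1 = y then a t else 0 with hF
  have hgS : ∀ t k, a (t + k) * g (S (t + k) ω).1 =
      if (S (t + k) ω).1 = y then a (t + k) else 0 := fun t k => by
    rw [hg, Pi.single_apply]
    split_ifs <;> simp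
  have hnn : ∀ t, 0 ≤ if (S t ω).1 = y then a t else 0 := fun t => by
    split_ifs
    exacts [ha0 t, le_rfl]
  have hwin : ∀ n, ∀ k ∈ T, ∑ t ∈ Finset.range n, a (t + N) * g (S (t + k) ω).1 ≤ F (n + N) := by
    intro n k hk
    calc ∑ t ∈ Finset.range n, a (t + N) * g (S (t + k) ω).1
        ≤ ∑ t ∈ Finset.range n, if (S (k + t) ω).1 = y then a (k + t) else 0 := by
          refine Finset.sum_le_sum fun t _ => ?_
          rw [add_comm k t, ← hgS]
          refine mul_le_mul_of_nonneg_right (hT k hk t) ?_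
          rw [hg, Pi.single_apply]
          split_ifs <;> norm_num
      _ ≤ F (k + n) := by
          simp only [hF]
          rw [Finset.sum_range_add]
          exact le_add_of_nonneg_left (Finset.sum_nonneg fun t _ => hnn t)
      _ ≤ F (n + N) := by
          refine Finset.sum_le_sum_of_subset_of_nonneg
            (Finset.range_subset_range.2 ?_) fun t _ _ => hnn t
          have := hTN k hk
          omega
  have hN : Tendsto (fun n => ∑ t ∈ Finset.range n, a (t + N)) atTop atTop := by
    have h1 : ∀ n, ∑ t ∈ Finset.range n, a (t + N) =
        -(∑ t ∈ Finset.range N, a t) + ∑ t ∈ Finset.range (n + N), a t := fun n => by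
      rw [add_comm n N, Finset.sum_range_add]
      simp_rw [add_comm N]
      ring
    simp_rw [h1]
    exact tendsto_atTop_add_const_left _ _ (ha1.comp (tendsto_add_atTop_nat N))
  -- Compensated visit indicators contribute convergent series, while the compensators, summed over
  -- the lags in `T`, are at least `c` in every slot. Since each lag contributes at most `F (n +
  -- N)`, the divergence passes to `T.card * F`.
  have hlow : Tendsto (fun n => c * ∑ t ∈ Finset.range n, a (t + N) +
      ∑ k ∈ T, ∑ t ∈ Finset.range n,
        a (t + N) * (g (S (t + k) ω).1 - (M.Pexo ^ k).mulVec g (S t ω).1)) atTop atTop :=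
    (hN.const_mul_atTop hc0).atTop_add (tendsto_finsetSum _ fun k _ => hl k)
  have hcard : Tendsto (fun n => (T.card : ℝ) * F (n + N)) atTop atTop := by
    refine tendsto_atTop_mono (fun n => ?_) hlow
    have h1 : c * ∑ t ∈ Finset.range n, a (t + N) ≤
        ∑ k ∈ T, ∑ t ∈ Finset.range n, a (t + N) * (M.Pexo ^ k).mulVec g (S t ω).1 := by
      rw [Finset.sum_comm, Finset.mul_sum]
      refine Finset.sum_le_sum fun t _ => ?_
      simp_rw [hPg]
      rw [← Finset.mul_sum, mul_comm c]
      exact mul_le_mul_of_nonneg_left (hx₀ _) (ha0 _)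
    have h2 := Finset.sum_le_sum (hwin n)
    rw [Finset.sum_const, nsmul_eq_mul] at h2
    simp_rw [mul_sub, Finset.sum_sub_distrib] at h1 h2 ⊢
    linarith
  rw [← tendsto_add_atTop_iff_nat N]
  exact (tendsto_const_mul_atTop_of_pos (Nat.cast_pos.2 hTne.card_pos)).1 hcard

/-- For a primitive chain one positive power suffices, and the single lag `k = N` makes the
comparison of rates trivial. A periodic chain needs a whole window of lags, and its rates might be
concentrated on the wrong residue class; monotonicity excludes this. -/
lemma ae_visits (hrun : M.IsRun P ℱ ρ α X₀ S A Γ) {a : ℕ → ℝ}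
    (ha0 : ∀ t, 0 ≤ a t) (ha1 : Tendsto (fun n => ∑ t ∈ Finset.range n, a t) atTop atTop)
    (ha2 : Summable fun t => a t ^ 2)
    (h : M.Pexo.IsPrimitive ∨ M.Pexo.IsIrreducible ∧ Antitone a) :
    ∀ᵐ ω ∂P, ∀ x, Tendsto (fun n => ∑ t ∈ Finset.range n, if (S t ω).1 = x then a t else 0)
      atTop atTop := by
  refine ae_all_iff.2 fun y => ?_
  have hnn : ∀ x y, 0 ≤ M.Pexo x y := fun x y =>
    Matrix.nonneg_of_mem_rowStochastic M.Pexo_mem_rowStochastic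
  rcases h with h | ⟨h, hanti⟩
  · obtain ⟨k, -, hk⟩ := h.exists_pos_pow
    exact hrun.ae_tendsto_sum_visits ha0 ha1 ha2 (T := {k}) (N := k) (by simp) (by simp)
      (by simpa using hk) y
  · choose k hk0 hk using (Matrix.isIrreducible_iff_exists_pow_pos hnn).1 h
    obtain ⟨N, hN⟩ := (Set.finite_range fun p : (W × E × H) × (W × E × H) => k p.1 p.2).bddAbove
    refine hrun.ae_tendsto_sum_visits ha0 ha1 ha2 (T := Finset.range (N + 1)) (N := N)
      (fun j hj => Nat.lt_succ_iff.1 (Finset.mem_range.1 hj))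
      (fun j hj t => hanti (Nat.add_le_add_left (Nat.lt_succ_iff.1 (Finset.mem_range.1 hj)) t))
      (fun x y => ?_) y
    refine Finset.sum_pos' (fun j _ => ?_) ⟨k x y, ?_, hk x y⟩
    · exact Matrix.nonneg_of_mem_rowStochastic (pow_mem M.Pexo_mem_rowStochastic j)
    · exact Finset.mem_range.2 (Nat.lt_succ_of_le (hN ⟨(x, y), rfl⟩))

end IsRun

end EdgeSystem

end

theorem theorem1 {L W E H G : Type*} [Fintype L] [Fintype W] [Fintype E] [Fintype H]
    [DecidableEq W] [DecidableEq E] [DecidableEq H] [Countable G] (M : EdgeSystem L W E H G)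
    {Ω : Type*} [mΩ : MeasurableSpace Ω] (P : Measure Ω) [IsProbabilityMeasure P]
    (ℱ : Filtration ℕ mΩ) (ρ α : ℕ → ℝ) (X₀ : M.Estimates) (S : ℕ → Ω → M.State)
    (A : (t : ℕ) → (ω : Ω) → M.Act (S t ω)) (Γ : ℕ → Ω → G)
    (hrun : M.IsRun P ℱ ρ α X₀ S A Γ)
    (hρ : ∀ t, 0 ≤ ρ t) (hα : ∀ t, 0 ≤ α t)
    (hρ1 : Tendsto (fun n => ∑ t ∈ Finset.range n, ρ t) atTop atTop)
    (hα1 : Tendsto (fun n => ∑ t ∈ Finset.range n, α t) atTop atTop)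
    (hρ2 : Summable fun t => ρ t ^ 2) (hα2 : Summable fun t => α t ^ 2) :
    -- `C*` is a function of `V*`
    (∀ s : M.State,
      M.optValue s = ⨅ a : M.Act s, (M.cost s a + M.disc * M.optPValue (M.post s a))) ∧
    -- almost sure convergence when the learning rates are not summable along the update slots
    (∀ᵐ ω ∂P,
      (∀ x : W × E × H, Tendsto (fun n => ∑ t ∈ Finset.range n,
        if (S t ω).1 = x then α t else 0) atTop atTop) →
      (∀ e : E, Tendsto (fun n => ∑ t ∈ Finset.range n,
        if (S t ω).1.2.1 = e then ρ t else 0) atTop atTop) →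
      M.Converges (M.estimates ρ α X₀ (fun t => (S t ω).1) (fun t => Γ t ω))) ∧
    -- unconditional almost sure convergence for an irreducible exogenous chain which is aperiodic,
    -- or whose learning rates are nonincreasing
    (M.Pexo.IsPrimitive ∨ (M.Pexo.IsIrreducible ∧ Antitone ρ ∧ Antitone α) →
      ∀ᵐ ω ∂P, M.Converges (M.estimates ρ α X₀ (fun t => (S t ω).1) (fun t => Γ t ω))) := by
  refine ⟨EdgeSystem.optValue_eq_iInf, hrun.ae_converges_of_visits hρ hα hρ2 hα2, fun hP => ?_⟩
  filter_upwards [hrun.ae_converges_of_visits hρ hα hρ2 hα2,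
    hrun.ae_visits hα hα1 hα2 (hP.imp_right fun h => ⟨h.1, h.2.2⟩),
    hrun.ae_visits hρ hρ1 hρ2 (hP.imp_right fun h => ⟨h.1, h.2.1⟩)] with ω hconv hαx hρx
  -- Visits to an environment state include those to any single exogenous state with that component;
  -- its other two components are arbitrary and are borrowed from `S 0 ω`.
  refine hconv hαx fun e => tendsto_atTop_mono (fun n => Finset.sum_le_sum fun t _ => ?_)
    (hρx ((S 0 ω).1.1, e, (S 0 ω).1.2.2))
  by_cases h : (S t ω).1 = ((S 0 ω).1.1, e, (S 0 ω).1.2.2)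
  · rw [if_pos h, if_pos (by rw [h])]
  · rw [if_neg h]
    split_ifs
    exacts [hρ t, le_rfl]
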